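/- Let $d\ge 2$ be an integer and $s\in(\frac12,\frac d2)$. Let $\sigma$ be the surface measure on the unit sphere $\mathbb S^{d-1}\subset\mathbb R^d$, let $\widehat f(\xi)=\int_{\mathbb R^d} f(x)e^{-ix\cdot\xi}\,dx$, $D=\sqrt{-\Delta}$ (so that $\widehat{D^{-s}g}(\xi)=|\xi|^{-s}\widehat g(\xi)$), and let $\mathcal R$ denote restriction of functions on $\mathbb R^d$ to $\mathbb S^{d-1}$. There is a unique bounded linear operator $\mathcal S=\mathcal R D^{-s}:L^2(\mathbb R^d)\to L^2(\mathbb S^{d-1},\sigma)$ (complex-valued functions) such that $\mathcal S g$ is the restriction to the sphere of the continuous function $D^{-s}g$ whenever $g \in L^2(\mathbb R^d)$ and $|\cdot|^{-s}\widehat g$ is integrable. Its adjoint $\mathcal S^*:L^2(\mathbb S^{d-1})\to L^2(\mathbb R^d)$ is given by $$\widehat{\mathcal S^*G}(\xi)=|\xi|^{-s}\,\widehat{G\,d\sigma}(\xi),\qquad \widehat{G\,d\sigma}(\xi)=\int_{\mathbb S^{d-1}}G(\omega)e^{-i\omega\cdot\xi}\,d\sigma(\omega),$$ for almost every $\xi$.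 For $k\in\mathbb N_0$ put $$\lambda_k=2^{1-2s}\,\frac{\Gamma(2s-1)\,\Gamma(k+\frac d2-s)}{\Gamma(s)^2\,\Gamma(k+\frac d2-1+s)}.$$ Then $\mathcal S\mathcal S^*P_k=\lambda_kP_k$ for every $k\in\mathbb N_0$ and every spherical harmonic $P_k$ of degree $k$ (the restriction to $\mathbb S^{d-1}$ of a homogeneous harmonic polynomial of degree $k$ with complex coefficients). The sequence $(\lambda_k)_{k\ge0}$ is strictly decreasing and converges to $0$. Moreover $$\|\mathcal S^*G\|_{L^2(\mathbb R^d)}^2\le\lambda_0\,\|G\|_{L^2(\mathbb S^{d-1})}^2\qquad\text{for all }G\in L^2(\mathbb S^{d-1}),$$ the constant $\lambda_0$ is optimal (the smallest with this property), and equality holds if and only if $G$ is constant (almost everywhere). -/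

import Mathlib

open MeasureTheory Filter Topology FourierTransform

noncomputable section

/-- `ℝ^d` with its Euclidean norm. -/
abbrev Rd (d : ℕ) : Type := EuclideanSpace ℝ (Fin d)

/-- The unit sphere `𝕊^{d-1}` of `ℝ^d`. -/
abbrev Sph (d : ℕ) : Type := Metric.sphere (0 : Rd d) 1

/-- The induced Lebesgue (surface) measure `dσ` on the unit sphere. -/
abbrev surf (d : ℕ) : Measure (Sph d) := (volume : Measure (Rd d)).toSphere

/-- `L²(ℝ^d)`, complex valued. -/
abbrev L2Rd (d : ℕ) : Type := Lp ℂ 2 (volume : Measure (Rd d))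

/-- `L²(𝕊^{d-1}, dσ)`, complex valued. -/
abbrev L2Sph (d : ℕ) : Type := Lp ℂ 2 (surf d)

/-- The Fourier transform of `D^{-s} g`, where `D = √(-Δ)` and `g ∈ L²(ℝ^d)`. Mathlib's Fourier
transform has the phase `exp (-2πi x·ξ)`, so that `D` has the symbol `‖2πξ‖`. -/
def dNegFourier {d : ℕ} (s : ℝ) (g : L2Rd d) : Rd d → ℂ :=
  fun ξ => ((‖(2 * Real.pi) • ξ‖ ^ (-s) : ℝ) : ℂ) * (𝓕 g : L2Rd d) ξ

/-- The function `D^{-s} g` on `ℝ^d`, given pointwise by the inverse Fourier integral of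
`dNegFourier s g`. It is meaningful (and then a bounded continuous function) when
`dNegFourier s g` is integrable. -/
def dNeg {d : ℕ} (s : ℝ) (g : L2Rd d) : Rd d → ℂ := 𝓕⁻ (dNegFourier s g)

/-- The operator `𝓡` which restricts functions on `ℝ^d` to the unit sphere. -/
def restrictSph {d : ℕ} (f : Rd d → ℂ) : Sph d → ℂ := fun ω => f ω

/-- `S` is the bounded linear operator `𝓡 D^{-s} : L²(ℝ^d) → L²(𝕊^{d-1})`: whenever `D^{-s} g` has
an integrable Fourier transform (so that it is a continuous function, and these `g` are dense
in `L²(ℝ^d)`), `S g` is its restriction to the sphere. On the other `g`, `S` is thus determined by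
continuity. -/
def IsTraceOp (d : ℕ) (s : ℝ) (S : L2Rd d →L[ℂ] L2Sph d) : Prop :=
  ∀ g : L2Rd d, Integrable (dNegFourier s g) →
    S g =ᵐ[surf d] restrictSph (dNeg s g)

/-- The Fourier transform `(G dσ)^(ξ) = ∫ G(ω) exp (-i ω·ξ) dσ(ω)` of the measure `G dσ`. -/
def extensionOp {d : ℕ} (G : L2Sph d) (ξ : Rd d) : ℂ :=
  ∫ ω : Sph d, Complex.exp (-Complex.I * ((inner ℝ (ω : Rd d) ξ : ℝ) : ℂ)) * G ω ∂(surf d)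

/-- The spherical harmonics of degree `k`, as elements of `L²(𝕊^{d-1})`: restrictions to the sphere
of homogeneous harmonic polynomials of degree `k` with complex coefficients. -/
def IsSphericalHarmonic (d k : ℕ) (Y : L2Sph d) : Prop :=
  ∃ P : MvPolynomial (Fin d) ℂ, P.IsHomogeneous k ∧
    ∑ i, MvPolynomial.pderiv i (MvPolynomial.pderiv i P) = 0 ∧
    Y =ᵐ[surf d] fun ω => MvPolynomial.eval (fun i => (((ω : Rd d) i : ℝ) : ℂ)) P

/-- The eigenvalue
`λ_k = 2^{1-2s} Γ(2s-1) Γ(k+d/2-s) / (Γ(s)² Γ(k+d/2-1+s))`. -/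
def traceEigenvalue (d : ℕ) (s : ℝ) (k : ℕ) : ℝ :=
  (2 : ℝ) ^ (1 - 2 * s) *
    (Real.Gamma (2 * s - 1) * Real.Gamma ((k : ℝ) + (d : ℝ) / 2 - s) /
      (Real.Gamma s ^ 2 * Real.Gamma ((k : ℝ) + (d : ℝ) / 2 - 1 + s)))

end

/-! Everything rests on computing `⟪S* H, S* G⟫` as a double integral over the sphere. By Plancherel
it is the integral over ξ of `|ξ|^(-2s)` times the product of conj `(H dσ)^` and `(G dσ)^`. Writing
`Γ(s) |ξ|^(-2s)` as the integral of `t^(s-1) exp(-t|ξ|²)` over `t > 0` makes each time slice a heat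
kernel pairing on the sphere, and integrating in `t` leaves the Riesz kernel `K(x,y) = c
|x-y|^(2s-d)` (`extSymbol_pairing`). So `S S*` is the integral operator with kernel `K`, a function
of `1 - x·y` which is integrable on the sphere because `s > 1/2`.

Its eigenvalues come from a Funk-Hecke formula. Gaussian integration by parts evaluates the integral
of `(x·y)^n P(y)` for `P` homogeneous harmonic (`gaussInt_linForm_pow_mul`). Polar coordinates turn
this into moments on the sphere, which match those of a Jacobi weight `(1-u²)^(p-1)`. Summing the
exponential series gives the formula for `exp(t x·ω)` (`funk_hecke_exp`), and a Gamma integral in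
`t` gives it for `(1 - x·ω)^(-c)` (`funk_hecke_rpow`). What remains is a beta integral, and the
duplication formula produces `λ_k` (`traceEigenvalue_eq`).

The sharp bound does not use completeness of the spherical harmonics. As `K(x,·)` has integral `λ_0`
for every `x`, the defect `λ_0 ‖G‖² - ‖S* G‖²` equals half the double integral of `K(x,y)
|G(x)-G(y)|²` (`dirichlet_form_eq`). It is nonnegative, and since `K > 0` off the null diagonal it
vanishes only for constants.

The operator is constructed from its adjoint: `traceAdjoint` is defined by the Fourier formula,
Fubini shows that its adjoint is a trace operator, and density of the `g` with Fourier support in an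
annulus gives uniqueness. -/

lemma nontrivial_Rd {d : ℕ} (hd : 0 < d) : Nontrivial (Rd d) :=
  have : Nonempty (Fin d) := ⟨⟨0, hd⟩⟩
  inferInstance

/-- The function on `ℝ^d` defined by a complex polynomial. -/
noncomputable def polyFun {d : ℕ} (P : MvPolynomial (Fin d) ℂ) (y : Rd d) : ℂ :=
  MvPolynomial.eval (fun i => ((y i : ℝ) : ℂ)) P

/-! ### Polynomials against the Gaussian weight and integration by parts. -/

section polyFun
variable {d : ℕ}

@[simp] lemma polyFun_add (P Q : MvPolynomial (Fin d) ℂ) (y : Rd d) :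
    polyFun (P + Q) y = polyFun P y + polyFun Q y := by simp [polyFun]

@[simp] lemma polyFun_mul (P Q : MvPolynomial (Fin d) ℂ) (y : Rd d) :
    polyFun (P * Q) y = polyFun P y * polyFun Q y := by simp [polyFun]

@[simp] lemma polyFun_pow (P : MvPolynomial (Fin d) ℂ) (n : ℕ) (y : Rd d) :
    polyFun (P ^ n) y = polyFun P y ^ n := by simp [polyFun]

@[simp] lemma polyFun_C (a : ℂ) (y : Rd d) : polyFun (MvPolynomial.C a) y = a := by simp [polyFun]

@[simp] lemma polyFun_zero (y : Rd d) : polyFun 0 y = 0 := by simp [polyFun]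

@[simp] lemma polyFun_one (y : Rd d) : polyFun 1 y = 1 := by simp [polyFun]

@[simp] lemma polyFun_X (i : Fin d) (y : Rd d) :
    polyFun (MvPolynomial.X i) y = ((y i : ℝ) : ℂ) := by simp [polyFun]

lemma polyFun_sum {ι : Type*} (t : Finset ι) (P : ι → MvPolynomial (Fin d) ℂ) (y : Rd d) :
    polyFun (∑ i ∈ t, P i) y = ∑ i ∈ t, polyFun (P i) y := by simp [polyFun]

lemma continuous_polyFun (P : MvPolynomial (Fin d) ℂ) : Continuous (polyFun P : Rd d → ℂ) := by
  induction P using MvPolynomial.induction_on with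
  | C a => simpa [funext fun y => polyFun_C a y] using continuous_const
  | add P Q hP hQ =>
    rw [funext fun y => polyFun_add P Q y]; exact hP.add hQ
  | mul_X P i hP =>
    rw [funext fun y => polyFun_mul P (MvPolynomial.X i) y]
    refine hP.mul ?_
    rw [funext fun y => polyFun_X i y]
    fun_prop

lemma polyFun_smul {k : ℕ} {P : MvPolynomial (Fin d) ℂ} (hP : P.IsHomogeneous k) (r : ℝ)
    (y : Rd d) : polyFun P (r • y) = (r : ℂ) ^ k * polyFun P y := by
  simp only [polyFun, MvPolynomial.eval_eq', Finset.mul_sum]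
  refine Finset.sum_congr rfl fun m hm => ?_
  have hk : ∑ i, m i = k := by
    have := hP (MvPolynomial.mem_support_iff.1 hm)
    simpa [Finsupp.weight_apply, Finsupp.sum_fintype] using this
  simp only [PiLp.smul_apply, smul_eq_mul, Complex.ofReal_mul, mul_pow, Finset.prod_mul_distrib,
    Finset.prod_pow_eq_pow_sum, hk]
  ring

lemma hasLineDerivAt_polyFun (P : MvPolynomial (Fin d) ℂ) (i : Fin d) (y : Rd d) :
    HasLineDerivAt ℝ (polyFun P) (polyFun (MvPolynomial.pderiv i P) y) y
      (EuclideanSpace.single i 1) := by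
  unfold HasLineDerivAt
  induction P using MvPolynomial.induction_on with
  | C a =>
    simp only [polyFun_C, MvPolynomial.pderiv_C]
    simpa only [polyFun_zero] using hasDerivAt_const (0 : ℝ) a
  | add P Q hP hQ =>
    simp only [polyFun_add, map_add]
    exact hP.add hQ
  | mul_X P j hP =>
    have h1 : HasDerivAt (fun t : ℝ => (((y + t • EuclideanSpace.single i (1 : ℝ)) j : ℝ) : ℂ))
        (((EuclideanSpace.single i (1 : ℝ) : Rd d) j : ℝ) : ℂ) 0 := by
      apply HasDerivAt.ofReal_comp
      simpa using ((hasDerivAt_id (0 : ℝ)).mul_const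
        ((EuclideanSpace.single i (1 : ℝ) : Rd d) j)).const_add (y j)
    have h2 := hP.mul h1
    simp only [polyFun_mul, polyFun_X]
    convert! h2 using 1
    simp only [Derivation.leibniz, MvPolynomial.pderiv_X, Pi.single_apply, smul_eq_mul,
      polyFun_add, polyFun_mul, polyFun_X, zero_smul, add_zero, PiLp.single_apply]
    split_ifs <;> simp <;> ring

lemma polyFun_growth (P : MvPolynomial (Fin d) ℂ) :
    ∃ (C : ℝ) (N : ℕ), ∀ y : Rd d, ‖polyFun P y‖ ≤ C * (1 + ‖y‖) ^ N := by
  induction P using MvPolynomial.induction_on with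
  | C a => exact ⟨‖a‖, 0, fun y => by simp⟩
  | add P Q hP hQ =>
    obtain ⟨C, N, h⟩ := hP
    obtain ⟨C', N', h'⟩ := hQ
    refine ⟨|C| + |C'|, N + N', fun y => ?_⟩
    have h1 : 1 ≤ 1 + ‖y‖ := by linarith [norm_nonneg y]
    rw [polyFun_add, add_mul]
    refine (norm_add_le _ _).trans (add_le_add ((h y).trans ?_) ((h' y).trans ?_))
    · exact mul_le_mul (le_abs_self _) (pow_le_pow_right₀ h1 (by omega)) (by positivity)
        (by positivity)
    · exact mul_le_mul (le_abs_self _) (pow_le_pow_right₀ h1 (by omega)) (by positivity)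
        (by positivity)
  | mul_X P i hP =>
    obtain ⟨C, N, h⟩ := hP
    refine ⟨C, N + 1, fun y => ?_⟩
    rw [polyFun_mul, norm_mul, pow_succ, ← mul_assoc]
    refine mul_le_mul (h y) ?_ (norm_nonneg _) ((norm_nonneg _).trans (h y))
    simp only [polyFun_X, Complex.norm_real]
    exact (PiLp.norm_apply_le y i).trans (by linarith)

/-- The Gaussian weight `exp (-‖y‖² / 2)`. -/
noncomputable def gaussWeight (y : Rd d) : ℂ := ((Real.exp (-‖y‖ ^ 2 / 2) : ℝ) : ℂ)

lemma continuous_gaussWeight : Continuous (gaussWeight : Rd d → ℂ) := by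
  unfold gaussWeight; fun_prop

lemma pow_mul_exp_neg_sq_bounded (N : ℕ) :
    ∃ C : ℝ, ∀ r : ℝ, 0 ≤ r → (1 + r) ^ N * Real.exp (-r ^ 2 / 2) ≤ C * Real.exp (-r ^ 2 / 4) := by
  -- The factor `exp 2` absorbs the linear exponent: `1 + r - r²/2 ≤ 2 - r²/4` is `(r-2)² ≥ 0`.
  refine ⟨N.factorial * Real.exp 2, fun r hr => ?_⟩
  have h1 : (1 + r) ^ N ≤ N.factorial * Real.exp (1 + r) := by
    have := Real.pow_div_factorial_le_exp (1 + r) (by linarith) N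
    rwa [div_le_iff₀ (by positivity), mul_comm] at this
  calc (1 + r) ^ N * Real.exp (-r ^ 2 / 2)
      ≤ (N.factorial * Real.exp (1 + r)) * Real.exp (-r ^ 2 / 2) := by gcongr
    _ = N.factorial * Real.exp (1 + r + -r ^ 2 / 2) := by rw [mul_assoc, Real.exp_add (1 + r)]
    _ ≤ N.factorial * Real.exp (2 + -r ^ 2 / 4) := by
        gcongr ?_ * Real.exp ?_
        nlinarith [sq_nonneg (r - 2)]
    _ = _ := by rw [Real.exp_add, mul_assoc]

lemma integrable_polyFun_mul_gaussWeight (P : MvPolynomial (Fin d) ℂ) :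
    Integrable (fun y : Rd d => polyFun P y * gaussWeight y) := by
  obtain ⟨C, N, h⟩ := polyFun_growth P
  obtain ⟨C', h'⟩ := pow_mul_exp_neg_sq_bounded N
  have hg : Integrable (fun y : Rd d => Real.exp (-(1 / 4) * ‖y‖ ^ 2)) := by
    have := (GaussianFourier.integrable_cexp_neg_mul_sq_norm_add (V := Rd d) (b := (1 / 4 : ℂ))
      (by norm_num) 0 0).norm
    refine this.congr (ae_of_all _ fun y => ?_)
    simp only [Complex.norm_exp]
    simp [← Complex.ofReal_pow]
  refine (hg.const_mul (|C| * |C'|)).mono'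
    ((continuous_polyFun P).mul continuous_gaussWeight).aestronglyMeasurable
    (ae_of_all _ fun y => ?_)
  have h3 := h' ‖y‖ (norm_nonneg y)
  rw [norm_mul, gaussWeight, Complex.norm_real, Real.norm_of_nonneg (Real.exp_pos _).le]
  calc ‖polyFun P y‖ * Real.exp (-‖y‖ ^ 2 / 2)
      ≤ (|C| * (1 + ‖y‖) ^ N) * Real.exp (-‖y‖ ^ 2 / 2) := by
        gcongr
        exact (h y).trans (by gcongr; exact le_abs_self _)
    _ = |C| * ((1 + ‖y‖) ^ N * Real.exp (-‖y‖ ^ 2 / 2)) := by ring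
    _ ≤ |C| * (|C'| * Real.exp (-‖y‖ ^ 2 / 4)) := by
        refine mul_le_mul_of_nonneg_left ?_ (abs_nonneg _)
        exact h3.trans (mul_le_mul_of_nonneg_right (le_abs_self _) (Real.exp_pos _).le)
    _ = _ := by rw [mul_assoc]; congr 3; ring

/-- The (unnormalized) Gaussian expectation of a polynomial. -/
noncomputable def gaussInt (P : MvPolynomial (Fin d) ℂ) : ℂ := ∫ y : Rd d, polyFun P y * gaussWeight y

lemma gaussInt_add (P Q : MvPolynomial (Fin d) ℂ) :
    gaussInt (P + Q) = gaussInt P + gaussInt Q := by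
  simp only [gaussInt, polyFun_add, add_mul]
  exact integral_add (integrable_polyFun_mul_gaussWeight P) (integrable_polyFun_mul_gaussWeight Q)

lemma gaussInt_C_mul (a : ℂ) (P : MvPolynomial (Fin d) ℂ) :
    gaussInt (MvPolynomial.C a * P) = a * gaussInt P := by
  simp only [gaussInt, polyFun_mul, polyFun_C, mul_assoc]
  exact integral_const_mul _ _

lemma gaussInt_zero : gaussInt (0 : MvPolynomial (Fin d) ℂ) = 0 := by
  simpa using gaussInt_C_mul 0 (0 : MvPolynomial (Fin d) ℂ)

lemma gaussInt_sum {ι : Type*} (t : Finset ι) (P : ι → MvPolynomial (Fin d) ℂ) :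
    gaussInt (∑ i ∈ t, P i) = ∑ i ∈ t, gaussInt (P i) := by
  classical
  induction t using Finset.induction_on with
  | empty => simp [gaussInt_zero]
  | insert i t hi h => rw [Finset.sum_insert hi, Finset.sum_insert hi, gaussInt_add, h]

lemma hasLineDerivAt_gaussWeight (i : Fin d) (y : Rd d) :
    HasLineDerivAt ℝ gaussWeight (-((y i : ℝ) : ℂ) * gaussWeight y) y
      (EuclideanSpace.single i 1) := by
  unfold HasLineDerivAt gaussWeight
  have h1 : ∀ t : ℝ, ‖y + t • EuclideanSpace.single i (1 : ℝ)‖ ^ 2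
      = ‖y‖ ^ 2 + 2 * (t * y i) + t ^ 2 := fun t => by
    rw [norm_add_sq_real, inner_smul_right, EuclideanSpace.inner_single_right, norm_smul]
    simp
  have h2 : HasDerivAt (fun t : ℝ => Real.exp (-(‖y‖ ^ 2 + 2 * (t * y i) + t ^ 2) / 2))
      (Real.exp (-(‖y‖ ^ 2 + 2 * (0 * y i) + 0 ^ 2) / 2) * (-y i)) 0 := by
    refine HasDerivAt.exp ?_
    have h := ((((hasDerivAt_id (0 : ℝ)).mul_const (y i)).const_mul 2).const_add (‖y‖ ^ 2)).add
      ((hasDerivAt_id (0 : ℝ)).pow 2)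
    convert! (h.neg.div_const 2) using 1
    simp; ring
  simp only [h1]
  convert! h2.ofReal_comp using 1
  push_cast
  simp [mul_comm]

/-- Gaussian integration by parts. -/
lemma gaussInt_X_mul (i : Fin d) (P : MvPolynomial (Fin d) ℂ) :
    gaussInt (MvPolynomial.X i * P) = gaussInt (MvPolynomial.pderiv i P) := by
  have h := integral_bilinear_hasLineDerivAt_right_eq_neg_left_of_integrable
    (μ := (volume : Measure (Rd d))) (B := ContinuousLinearMap.mul ℝ ℂ)
    (f := polyFun P) (f' := polyFun (MvPolynomial.pderiv i P)) (g := gaussWeight)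
    (g' := fun y => -((y i : ℝ) : ℂ) * gaussWeight y) (v := EuclideanSpace.single i 1)
    (by simpa using integrable_polyFun_mul_gaussWeight (MvPolynomial.pderiv i P))
    (by
      have := (integrable_polyFun_mul_gaussWeight (MvPolynomial.X i * P)).neg
      refine this.congr (ae_of_all _ fun y => ?_)
      simp; ring)
    (by simpa using integrable_polyFun_mul_gaussWeight P)
    (fun y _ => hasLineDerivAt_polyFun P i y) (fun y _ => hasLineDerivAt_gaussWeight i y)
  simp only [ContinuousLinearMap.mul_apply'] at h
  rw [gaussInt, gaussInt, ← neg_inj, ← h, ← integral_neg]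
  congr 1; ext y; simp; ring

end polyFun

/-! ### Gaussian integrals of powers of a linear form times a harmonic polynomial. -/

section harmonic
variable {d : ℕ}

/-- The linear form `y ↦ x · y` as a polynomial. -/
noncomputable def linForm (x : Rd d) : MvPolynomial (Fin d) ℂ :=
  ∑ i, MvPolynomial.C ((x i : ℝ) : ℂ) * MvPolynomial.X i

lemma polyFun_linForm (x y : Rd d) : polyFun (linForm x) y = ((inner ℝ x y : ℝ) : ℂ) := by
  simp [linForm, polyFun_sum, PiLp.inner_apply, mul_comm]

lemma pderiv_linForm (x : Rd d) (i : Fin d) :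
    MvPolynomial.pderiv i (linForm x) = MvPolynomial.C ((x i : ℝ) : ℂ) := by
  classical
  simp [linForm, MvPolynomial.pderiv_X, Pi.single_apply]

/-- The derivative of a polynomial in the direction `x`. -/
noncomputable def dirDeriv (x : Rd d) (P : MvPolynomial (Fin d) ℂ) : MvPolynomial (Fin d) ℂ :=
  ∑ i, MvPolynomial.C ((x i : ℝ) : ℂ) * MvPolynomial.pderiv i P

/-- A homogeneous harmonic polynomial of degree `k`. -/
def IsHomHarmonic (k : ℕ) (P : MvPolynomial (Fin d) ℂ) : Prop :=
  P.IsHomogeneous k ∧ ∑ i, MvPolynomial.pderiv i (MvPolynomial.pderiv i P) = 0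

lemma pderiv_comm (i j : Fin d) (P : MvPolynomial (Fin d) ℂ) :
    MvPolynomial.pderiv i (MvPolynomial.pderiv j P) =
      MvPolynomial.pderiv j (MvPolynomial.pderiv i P) := by
  classical
  induction P using MvPolynomial.induction_on with
  | C a => simp
  | add P Q hP hQ => simp [hP, hQ]
  | mul_X P l hP =>
    simp only [Derivation.leibniz, MvPolynomial.pderiv_X, Pi.single_apply, smul_eq_mul, map_add, hP]
    split_ifs <;> simp <;> ring

/-- A constant-coefficient derivative commutes with the Laplacian. For `k = 0` the derivative is
zero, hence homogeneous of every degree, so the truncated `k - 1` is harmless. -/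
lemma IsHomHarmonic.dirDeriv {k : ℕ} {P : MvPolynomial (Fin d) ℂ} (hP : IsHomHarmonic k P)
    (x : Rd d) : IsHomHarmonic (k - 1) (dirDeriv x P) := by
  refine ⟨MvPolynomial.IsHomogeneous.sum _ _ _ fun i _ => ?_, ?_⟩
  · simpa using (MvPolynomial.isHomogeneous_C (Fin d) ((x i : ℝ) : ℂ)).mul hP.1.pderiv
  · have h : ∀ j, MvPolynomial.pderiv j (MvPolynomial.pderiv j (_root_.dirDeriv x P)) =
        ∑ i, MvPolynomial.C ((x i : ℝ) : ℂ) *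
          MvPolynomial.pderiv i (MvPolynomial.pderiv j (MvPolynomial.pderiv j P)) := fun j => by
      simp only [_root_.dirDeriv, map_sum, MvPolynomial.pderiv_C_mul]
      refine Finset.sum_congr rfl fun i _ => ?_
      rw [pderiv_comm j i P, pderiv_comm j i]
    simp only [h]
    rw [Finset.sum_comm]
    simp only [← Finset.mul_sum, ← map_sum, hP.2]
    simp

lemma polyFun_dirDeriv_self {k : ℕ} {P : MvPolynomial (Fin d) ℂ} (hP : P.IsHomogeneous k)
    (x : Rd d) : polyFun (dirDeriv x P) x = k * polyFun P x := by
  have h := congrArg (fun Q => polyFun Q x) hP.sum_X_mul_pderiv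
  simp only [polyFun_sum, polyFun_mul, polyFun_X] at h
  simp only [dirDeriv, polyFun_sum, polyFun_mul, polyFun_C, h]
  simp [polyFun]

lemma gaussInt_linForm_mul (x : Rd d) (P : MvPolynomial (Fin d) ℂ) :
    gaussInt (linForm x * P) = gaussInt (dirDeriv x P) := by
  simp only [linForm, dirDeriv, Finset.sum_mul, gaussInt_sum, mul_assoc, gaussInt_C_mul,
    gaussInt_X_mul]

lemma dirDeriv_linForm_pow_mul (x : Rd d) (n : ℕ) (P : MvPolynomial (Fin d) ℂ) :
    dirDeriv x (linForm x ^ (n + 1) * P) =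
      MvPolynomial.C ((n + 1 : ℂ) * (‖x‖ ^ 2 : ℝ)) * (linForm x ^ n * P) +
        linForm x ^ (n + 1) * dirDeriv x P := by
  have h : MvPolynomial.C ((‖x‖ ^ 2 : ℝ) : ℂ) =
      ∑ i : Fin d, MvPolynomial.C (σ := Fin d) (((x i : ℝ) : ℂ) ^ 2) := by
    rw [EuclideanSpace.norm_sq_eq, ← map_sum]
    simp
  rw [map_mul, h]
  simp only [dirDeriv, Derivation.leibniz, Derivation.leibniz_pow, pderiv_linForm, smul_eq_mul,
    Finset.mul_sum, Finset.sum_mul, ← Finset.sum_add_distrib, nsmul_eq_mul]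
  refine Finset.sum_congr rfl fun i _ => ?_
  simp
  ring

/-- By Euler's identity `k P` is the sum of `X i * ∂ᵢP`, and integration by parts turns its integral
into that of the Laplacian of `P`. -/
lemma gaussInt_eq_zero {k : ℕ} (hk : k ≠ 0) {P : MvPolynomial (Fin d) ℂ}
    (hP : IsHomHarmonic k P) : gaussInt P = 0 := by
  have h := congrArg gaussInt hP.1.sum_X_mul_pderiv
  simp only [gaussInt_sum, gaussInt_X_mul] at h
  rw [← gaussInt_sum, hP.2, gaussInt_zero, nsmul_eq_mul, ← map_natCast MvPolynomial.C,
    gaussInt_C_mul] at h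
  simpa [hk] using h.symm

/-- The moments `1, 0, 1, 0, 3, 0, 15, …` of the standard normal distribution. -/
def normalMoment : ℕ → ℝ
  | 0 => 1
  | 1 => 0
  | (n + 2) => (n + 1) * normalMoment n

/-- The coefficient identity behind the induction in `gaussInt_linForm_pow_mul`, for degree `k + 1`.
Whenever one of the differences of indices truncates, the falling factorial in front of it is zero.
-/
lemma descFactorial_mul_normalMoment_rec (n k : ℕ) :
    (n + 1 : ℝ) * (n.descFactorial (k + 1) * normalMoment (n - (k + 1))) +
      (n + 1).descFactorial k * normalMoment (n + 1 - k) * (k + 1) =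
    (n + 2).descFactorial (k + 1) * normalMoment (n + 1 - k) := by
  have h1 : (n + 1) * n.descFactorial (k + 1) =
      (n + 1 - (k + 1)) * ((n + 1 - k) * (n + 1).descFactorial k) := by
    rw [← Nat.succ_descFactorial_succ, Nat.descFactorial_succ, Nat.descFactorial_succ]
  have h2 : (n + 2).descFactorial (k + 1) = (n + 2) * (n + 1).descFactorial k :=
    Nat.succ_descFactorial_succ _ _
  have h1' : (n + 1 : ℝ) * n.descFactorial (k + 1) =
      (n + 1 - (k + 1) : ℕ) * ((n + 1 - k : ℕ) * (n + 1).descFactorial k) := by exact_mod_cast h1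
  rw [← mul_assoc, h1', h2]
  rcases lt_or_ge (n + 1) k with hk | hk
  · simp [Nat.descFactorial_eq_zero_iff_lt.2 hk]
  · obtain ⟨j, hj⟩ := Nat.exists_eq_add_of_le hk
    have hn : (n : ℝ) + 1 = k + j := by exact_mod_cast hj
    rw [show n + 1 - (k + 1) = j - 1 by omega, show n + 1 - k = j by omega,
      show n - (k + 1) = j - 2 by omega]
    push_cast
    rw [show (n : ℝ) + 2 = k + j + 1 by linarith]
    obtain _ | _ | j := j
    · simp; ring
    · simp [normalMoment]
    · simp [normalMoment]; ring

/-- Gaussian integrals of a power of a linear form against a harmonic polynomial. -/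
lemma gaussInt_linForm_pow_mul {x : Rd d} (hx : ‖x‖ = 1) (n : ℕ) :
    ∀ (k : ℕ) (P : MvPolynomial (Fin d) ℂ), IsHomHarmonic k P →
      gaussInt (linForm x ^ n * P) =
        (n.descFactorial k * normalMoment (n - k) : ℝ) * gaussInt (1 : MvPolynomial (Fin d) ℂ) *
          polyFun P x := by
  induction n using Nat.strong_induction_on with
  | _ n ih =>
  intro k P hP
  obtain _ | _ | n := n
  · rcases eq_or_ne k 0 with rfl | hk
    · have h0 := hP.1.totalDegree_le
      obtain ⟨a, rfl⟩ : ∃ a, P = MvPolynomial.C a :=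
        ⟨_, MvPolynomial.totalDegree_eq_zero_iff_eq_C.1 (Nat.le_zero.1 h0)⟩
      have := gaussInt_C_mul a (1 : MvPolynomial (Fin d) ℂ)
      rw [mul_one] at this
      simp [this, normalMoment, mul_comm]
    · rw [pow_zero, one_mul, gaussInt_eq_zero hk hP]
      simp [Nat.descFactorial_eq_zero_iff_lt.2 (Nat.pos_of_ne_zero hk)]
  · have h0 := ih 0 (by omega) (k - 1) _ (hP.dirDeriv x)
    rw [pow_zero, one_mul] at h0
    rw [zero_add, pow_one, gaussInt_linForm_mul, h0, polyFun_dirDeriv_self hP.1]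
    obtain _ | _ | k := k
    · simp [normalMoment]
    · simp [normalMoment]
    · simp [Nat.descFactorial]
  -- One factor `x·y` is integrated by parts. The derivative falls either on the other `n + 1`
  -- linear factors, each giving `‖x‖² = 1`, or on `P`; the latter is covered by the induction
  -- hypothesis in degree `k - 1`, and Euler's identity gives the value `k P(x)` of the derivative
  -- at `x`.
  · have h0 := ih n (by omega) k _ hP
    have h1 := ih (n + 1) (by omega) (k - 1) _ (hP.dirDeriv x)
    rw [pow_succ', mul_assoc, gaussInt_linForm_mul, dirDeriv_linForm_pow_mul, gaussInt_add,
      gaussInt_C_mul, h0, h1, polyFun_dirDeriv_self hP.1, hx]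
    have key : ((n + 1 : ℝ)) * (n.descFactorial k * normalMoment (n - k)) +
        (n + 1).descFactorial (k - 1) * normalMoment (n + 1 - (k - 1)) * k =
        (n + 2).descFactorial k * normalMoment (n + 2 - k) := by
      obtain _ | k := k
      · simp [normalMoment]
      · simpa using descFactorial_mul_normalMoment_rec n k
    rw [show n + 1 + 1 = n + 2 from rfl, ← key]
    push_cast
    ring

end harmonic

/-! ### Jacobi weights, their moments, and radial Gaussian moments. -/

section jacobi

/-- The Jacobi weight on `(-1, 1)`. -/
noncomputable def jacobiWeight (a b u : ℝ) : ℝ := (1 - u) ^ (a - 1) * (1 + u) ^ (b - 1)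

lemma jacobiWeight_nonneg (a b : ℝ) {u : ℝ} (hu : u ∈ Set.Ioo (-1) 1) :
    0 ≤ jacobiWeight a b u := by
  have h1 : 0 < 1 - u := by linarith [hu.2]
  have h2 : 0 < 1 + u := by linarith [hu.1]
  unfold jacobiWeight; positivity

lemma measurable_jacobiWeight (a b : ℝ) : Measurable (jacobiWeight a b) := by
  unfold jacobiWeight; fun_prop

lemma betaIntegrand_eq {a b x : ℝ} (hx : x ∈ Set.Icc (0 : ℝ) 1) :
    ((x : ℂ) ^ ((b : ℂ) - 1) * (1 - (x : ℂ)) ^ ((a : ℂ) - 1)) =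
      ((x ^ (b - 1) * (1 - x) ^ (a - 1) : ℝ) : ℂ) := by
  have h1 : 0 ≤ 1 - x := by linarith [hx.2]
  push_cast [Complex.ofReal_cpow hx.1, Complex.ofReal_cpow h1]
  rfl

lemma intervalIntegrable_beta {a b : ℝ} (ha : 0 < a) (hb : 0 < b) :
    IntervalIntegrable (fun x : ℝ => x ^ (b - 1) * (1 - x) ^ (a - 1)) volume 0 1 := by
  have h := Complex.betaIntegral_convergent (u := b) (v := a) (by simpa) (by simpa)
  rw [intervalIntegrable_iff_integrableOn_Icc_of_le zero_le_one] at h ⊢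
  have h' : IntegrableOn (fun x : ℝ => ((x ^ (b - 1) * (1 - x) ^ (a - 1) : ℝ) : ℂ))
      (Set.Icc 0 1) volume :=
    h.congr_fun (fun x hx => betaIntegrand_eq hx) measurableSet_Icc
  have h2 := h'.re
  simp only [RCLike.re_to_complex, Complex.ofReal_re] at h2
  exact h2

lemma integral_beta {a b : ℝ} (ha : 0 < a) (hb : 0 < b) :
    ∫ x in (0 : ℝ)..1, x ^ (b - 1) * (1 - x) ^ (a - 1) =
      Real.Gamma a * Real.Gamma b / Real.Gamma (a + b) := by
  have h := Complex.betaIntegral_eq_Gamma_mul_div b a (by simpa) (by simpa)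
  rw [Complex.betaIntegral, intervalIntegral.integral_congr (g := fun x : ℝ =>
    ((x ^ (b - 1) * (1 - x) ^ (a - 1) : ℝ) : ℂ)) (fun x hx => betaIntegrand_eq
      (by simpa using hx)), intervalIntegral.integral_ofReal, ← Complex.ofReal_add] at h
  simp only [Complex.Gamma_ofReal] at h
  rw [add_comm a b, mul_comm (Real.Gamma a)]
  exact_mod_cast h

lemma jacobiWeight_comp (a b x : ℝ) (hx : x ∈ Set.Icc (0 : ℝ) 1) :
    jacobiWeight a b (2 * x - 1) = 2 ^ (a + b - 2) * (x ^ (b - 1) * (1 - x) ^ (a - 1)) := by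
  have h1 : 0 ≤ 1 - x := by linarith [hx.2]
  rw [jacobiWeight, show 1 - (2 * x - 1) = 2 * (1 - x) by ring,
    show 1 + (2 * x - 1) = 2 * x by ring, Real.mul_rpow zero_le_two h1,
    Real.mul_rpow zero_le_two hx.1, show a + b - 2 = (a - 1) + (b - 1) by ring,
    Real.rpow_add two_pos]
  ring

lemma intervalIntegrable_jacobiWeight {a b : ℝ} (ha : 0 < a) (hb : 0 < b) :
    IntervalIntegrable (jacobiWeight a b) volume (-1) 1 := by
  have h : IntervalIntegrable (fun x => jacobiWeight a b (2 * x - 1)) volume 0 1 := by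
    refine ((intervalIntegrable_beta ha hb).const_mul (2 ^ (a + b - 2))).congr ?_
    intro x hx
    rw [Set.uIoc_of_le zero_le_one] at hx
    exact (jacobiWeight_comp a b x ⟨hx.1.le, hx.2⟩).symm
  have h2 := (h.comp_add_right (1 / 2)).comp_mul_left (c := 1 / 2)
  norm_num at h2
  refine h2.congr fun u _ => ?_
  ring_nf

lemma integrableOn_jacobiWeight {a b : ℝ} (ha : 0 < a) (hb : 0 < b) :
    IntegrableOn (jacobiWeight a b) (Set.Ioo (-1) 1) := by
  have := intervalIntegrable_jacobiWeight ha hb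
  rwa [intervalIntegrable_iff_integrableOn_Ioo_of_le (by norm_num)] at this

lemma integral_jacobiWeight {a b : ℝ} (ha : 0 < a) (hb : 0 < b) :
    ∫ u in Set.Ioo (-1 : ℝ) 1, jacobiWeight a b u =
      2 ^ (a + b - 1) * (Real.Gamma a * Real.Gamma b / Real.Gamma (a + b)) := by
  have h := intervalIntegral.integral_comp_mul_sub (a := 0) (b := 1) (jacobiWeight a b)
    (two_ne_zero) 1
  rw [intervalIntegral.integral_congr (g := fun x : ℝ =>
    2 ^ (a + b - 2) * (x ^ (b - 1) * (1 - x) ^ (a - 1))) (fun x hx => jacobiWeight_comp a b x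
      (by simpa using hx)), intervalIntegral.integral_const_mul, integral_beta ha hb] at h
  norm_num at h
  rw [← integral_Ioc_eq_integral_Ioo, ← intervalIntegral.integral_of_le (by norm_num),
    show a + b - 1 = (a + b - 2) + 1 by ring, Real.rpow_add two_pos, Real.rpow_one]
  linarith

/-- The moments of the symmetric Jacobi weight `(1 - u²)^(p-1)`. -/
noncomputable def jacobiMoment (p : ℝ) (j : ℕ) : ℝ :=
  ∫ u in Set.Ioo (-1 : ℝ) 1, u ^ j * jacobiWeight p p u

lemma integrableOn_mul_jacobiWeight {a b : ℝ} (ha : 0 < a) (hb : 0 < b) {f : ℝ → ℝ}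
    (hf : Continuous f) :
    IntegrableOn (fun u => f u * jacobiWeight a b u) (Set.Ioo (-1) 1) := by
  obtain ⟨C, hC⟩ := isCompact_Icc.exists_bound_of_continuousOn (s := Set.Icc (-1 : ℝ) 1)
    hf.continuousOn
  exact (integrableOn_jacobiWeight ha hb).bdd_mul hf.aestronglyMeasurable
    (ae_restrict_of_forall_mem measurableSet_Ioo fun u hu => hC u (Set.Ioo_subset_Icc_self hu))

lemma hasDerivAt_one_sub_sq_rpow {p u : ℝ} (hu : u ∈ Set.Ioo (-1 : ℝ) 1) :
    HasDerivAt (fun u : ℝ => (1 - u ^ 2) ^ p) (-2 * p * u * jacobiWeight p p u) u := by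
  have h1 : 0 < 1 - u := by linarith [hu.2]
  have h2 : 0 < 1 + u := by linarith [hu.1]
  have h3 : 1 - u ^ 2 = (1 - u) * (1 + u) := by ring
  have h := (((hasDerivAt_id u).pow 2).const_sub 1).rpow_const (p := p)
    (Or.inl (by simp only [Pi.pow_apply, id]; rw [h3]; positivity))
  convert! h using 1
  simp only [jacobiWeight, Pi.pow_apply, id, h3]
  rw [Real.mul_rpow h1.le h2.le]
  push_cast; ring

lemma one_sub_sq_rpow_eq {p u : ℝ} (hu : u ∈ Set.Ioo (-1 : ℝ) 1) :
    (1 - u ^ 2) ^ p = (1 - u ^ 2) * jacobiWeight p p u := by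
  have h1 : 0 < 1 - u := by linarith [hu.2]
  have h2 : 0 < 1 + u := by linarith [hu.1]
  have h3 : 1 - u ^ 2 = (1 - u) * (1 + u) := by ring
  have h4 : 0 < 1 - u ^ 2 := by rw [h3]; positivity
  rw [jacobiWeight, ← Real.mul_rpow h1.le h2.le, ← h3, Real.rpow_sub_one h4.ne']
  field_simp

lemma integral_Ioo_eq_zero_of_hasDerivAt {f f' : ℝ → ℝ} (hf : Continuous f)
    (hd : ∀ u ∈ Set.Ioo (-1 : ℝ) 1, HasDerivAt f (f' u) u)
    (hi : IntegrableOn f' (Set.Ioo (-1) 1)) (h1 : f 1 = f (-1)) :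
    ∫ u in Set.Ioo (-1 : ℝ) 1, f' u = 0 := by
  have h := intervalIntegral.integral_eq_sub_of_hasDerivAt_of_le (a := (-1 : ℝ)) (b := 1)
    (by norm_num) hf.continuousOn hd
    ((intervalIntegrable_iff_integrableOn_Ioo_of_le (by norm_num)).2 hi)
  rw [h1, sub_self, intervalIntegral.integral_of_le (by norm_num),
    integral_Ioc_eq_integral_Ioo] at h
  exact h

lemma jacobiMoment_one {p : ℝ} (hp : 0 < p) : jacobiMoment p 1 = 0 := by
  have h := integral_Ioo_eq_zero_of_hasDerivAt (f := fun u : ℝ => (1 - u ^ 2) ^ p)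
    (by refine Continuous.rpow_const (by fun_prop) fun _ => Or.inr hp.le)
    (fun u hu => hasDerivAt_one_sub_sq_rpow hu)
    (by simpa only [mul_assoc] using integrableOn_mul_jacobiWeight hp hp
          (f := fun u => -2 * p * u) (by fun_prop)) (by norm_num)
  have h2 : ∫ u in Set.Ioo (-1 : ℝ) 1, -2 * p * u * jacobiWeight p p u =
      -2 * p * jacobiMoment p 1 := by
    rw [jacobiMoment, ← integral_const_mul]
    congr 1; ext u; ring
  rw [h2] at h
  simpa [hp.ne'] using h

/-- The derivative of `u^(j+1) (1-u²)^p` integrates to zero, as the function vanishes at both end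
points. -/
lemma jacobiMoment_add_two {p : ℝ} (hp : 0 < p) (j : ℕ) :
    (j + 1 + 2 * p) * jacobiMoment p (j + 2) = (j + 1) * jacobiMoment p j := by
  have hI : ∀ n : ℕ, IntegrableOn (fun u : ℝ => u ^ n * jacobiWeight p p u) (Set.Ioo (-1) 1) :=
    fun n => integrableOn_mul_jacobiWeight hp hp (by fun_prop)
  have h := integral_Ioo_eq_zero_of_hasDerivAt
    (f := fun u : ℝ => u ^ (j + 1) * (1 - u ^ 2) ^ p)
    (f' := fun u => (j + 1) * (u ^ j * jacobiWeight p p u) -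
      (j + 1 + 2 * p) * (u ^ (j + 2) * jacobiWeight p p u))
    (by refine Continuous.mul (by fun_prop)
          (Continuous.rpow_const (by fun_prop) fun _ => Or.inr hp.le))
    (fun u hu => by
      have := (hasDerivAt_pow (j + 1) u).mul (hasDerivAt_one_sub_sq_rpow (p := p) hu)
      convert! this using 1
      rw [one_sub_sq_rpow_eq hu]
      simp only [Nat.add_sub_cancel]
      push_cast; ring)
    (((hI j).const_mul _).sub ((hI (j + 2)).const_mul _))
    (by simp [hp.ne'])
  rw [integral_sub ((hI j).const_mul _) ((hI (j + 2)).const_mul _), integral_const_mul,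
    integral_const_mul] at h
  simp only [jacobiMoment]
  linarith

/-- The beta value `2^(2p-1) Γ(p)² / Γ(2p)`, with `Γ(2p)` removed by the duplication formula. -/
lemma jacobiMoment_zero {p : ℝ} (hp : 0 < p) :
    jacobiMoment p 0 = √Real.pi * Real.Gamma p / Real.Gamma (p + 1 / 2) := by
  have h := integral_jacobiWeight hp hp
  simp only [jacobiMoment, pow_zero, one_mul, h]
  have h2 := Real.Gamma_mul_Gamma_add_half p
  have g1 := Real.Gamma_pos_of_pos hp
  have g2 := Real.Gamma_pos_of_pos (by linarith : 0 < p + 1 / 2)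
  have g3 := Real.Gamma_pos_of_pos (by linarith : 0 < 2 * p)
  have h3 : (2 : ℝ) ^ (p + p - 1) * 2 ^ (1 - 2 * p) = 1 := by
    rw [← Real.rpow_add two_pos]; ring_nf; exact Real.rpow_zero 2
  rw [← two_mul] at h3 ⊢
  rw [mul_div_assoc', div_eq_div_iff g3.ne' g2.ne']
  have : Real.Gamma p * Real.Gamma (p + 1 / 2) * 2 ^ (2 * p - 1) = Real.Gamma (2 * p) * √Real.pi := by
    rw [h2]; linear_combination (Real.Gamma (2 * p) * √Real.pi) * h3
  linear_combination Real.Gamma p * this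

/-- `∫₀^∞ r^(q+d-1) exp (-r²/2) dr`. -/
noncomputable def radialMoment (d q : ℕ) : ℝ :=
  2 ^ (((q + d : ℕ) : ℝ) / 2 - 1) * Real.Gamma (((q + d : ℕ) : ℝ) / 2)

lemma radialMoment_pos {d : ℕ} (hd : 0 < d) (q : ℕ) : 0 < radialMoment d q := by
  have : 0 < ((q + d : ℕ) : ℝ) / 2 := by positivity
  have := Real.Gamma_pos_of_pos this
  unfold radialMoment; positivity

lemma radialMoment_add_two {d : ℕ} (hd : 0 < d) (q : ℕ) :
    radialMoment d (q + 2) = (q + d) * radialMoment d q := by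
  have h : ((q + d : ℕ) : ℝ) / 2 ≠ 0 := by positivity
  rw [radialMoment, radialMoment,
    show ((q + 2 + d : ℕ) : ℝ) / 2 = ((q + d : ℕ) : ℝ) / 2 + 1 by push_cast; ring,
    Real.Gamma_add_one h, show ((q + d : ℕ) : ℝ) / 2 + 1 - 1 = (((q + d : ℕ) : ℝ) / 2 - 1) + 1 by ring,
    Real.rpow_add two_pos, Real.rpow_one]
  push_cast; ring

lemma integral_radialMoment {d : ℕ} (hd : 0 < d) (q : ℕ) :
    ∫ r in Set.Ioi (0 : ℝ), r ^ (q + d - 1) * Real.exp (-r ^ 2 / 2) = radialMoment d q := by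
  have h := integral_rpow_mul_exp_neg_mul_rpow (p := 2) (q := ((q + d - 1 : ℕ) : ℝ)) (b := 1 / 2)
    two_pos (by have : (0 : ℝ) ≤ ((q + d - 1 : ℕ) : ℝ) := by positivity
                linarith) (by norm_num)
  have hc : ((q + d - 1 : ℕ) : ℝ) + 1 = ((q + d : ℕ) : ℝ) := by
    rw [← Nat.cast_add_one]; congr 1; omega
  rw [hc] at h
  rw [radialMoment, Real.rpow_sub_one two_ne_zero]
  have e : ((1 : ℝ) / 2) ^ (-((q + d : ℕ) : ℝ) / 2) = 2 ^ (((q + d : ℕ) : ℝ) / 2) := by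
    rw [one_div, Real.inv_rpow zero_le_two, ← Real.rpow_neg zero_le_two]
    congr 1; ring
  rw [e] at h
  rw [div_eq_mul_one_div, ← h]
  refine setIntegral_congr_fun measurableSet_Ioi fun r _ => ?_
  simp only [Real.rpow_natCast, Real.rpow_two]
  congr 2; ring

/-- One-dimensional Jacobi moments in terms of Gaussian moments. -/
lemma normalMoment_mul_jacobiMoment {d : ℕ} (hd : 2 ≤ d) (k : ℕ) (j : ℕ) :
    normalMoment j * (jacobiMoment (k + (d - 1) / 2) 0 * radialMoment d (2 * k)) =
      jacobiMoment (k + (d - 1) / 2) j * radialMoment d (2 * k + j) := by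
  have hd' : (2 : ℝ) ≤ d := by exact_mod_cast hd
  have hp : 0 < (k + (d - 1) / 2 : ℝ) := by
    have : (0 : ℝ) ≤ k := by positivity
    linarith
  -- Both sides obey the same two-step recursion: with `p = k + (d-1)/2`, the radial factor `2k + j
  -- + d` is the denominator `j + 1 + 2p` of the Jacobi recursion, and the numerator `j + 1` is that
  -- of the normal moments.
  induction j using Nat.twoStepInduction with
  | zero => simp [normalMoment]
  | one => simp [normalMoment, jacobiMoment_one hp]
  | more j h1 h2 =>
    rw [normalMoment, ← add_assoc, radialMoment_add_two (by omega), mul_assoc, h1]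
    have := jacobiMoment_add_two hp j
    push_cast
    linear_combination -radialMoment d (2 * k + j) * this

end jacobi

/-! ### Moments on the sphere and the Funk-Hecke formula for exponentials. -/

section sphere
variable {d : ℕ}

lemma continuous_polyFun_sph (P : MvPolynomial (Fin d) ℂ) :
    Continuous (fun ω : Sph d => polyFun P (ω : Rd d)) :=
  (continuous_polyFun P).comp continuous_subtype_val

lemma integrable_sph_of_continuous {E : Type*} [NormedAddCommGroup E] {f : Sph d → E}
    (hf : Continuous f) : Integrable f (surf d) := by
  obtain ⟨C, hC⟩ := isCompact_univ.exists_bound_of_continuousOn (s := Set.univ) hf.continuousOn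
  exact Integrable.of_bound hf.aestronglyMeasurable_of_compactSpace C
    (ae_of_all _ fun x => hC x (Set.mem_univ x))

/-- Gaussian integrals of homogeneous polynomials in polar coordinates. -/
lemma gaussInt_eq_sphere (hd : 0 < d) {q : ℕ} {Q : MvPolynomial (Fin d) ℂ}
    (hQ : Q.IsHomogeneous q) :
    gaussInt Q = radialMoment d q * ∫ ω : Sph d, polyFun Q ω ∂(surf d) := by
  have := nontrivial_Rd hd
  -- Homogeneity contributes `r^q` to the radial factor; the remaining `r^(d-1)` is the density of
  -- `Measure.volumeIoiPow`.
  set g : ℝ → ℂ := fun r => ((r ^ q * Real.exp (-r ^ 2 / 2) : ℝ) : ℂ) with hg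
  have h1 : gaussInt Q = ∫ x : ({0}ᶜ : Set (Rd d)), polyFun Q x.1 * gaussWeight x.1
      ∂((volume : Measure (Rd d)).comap Subtype.val) := by
    rw [integral_subtype_comap (measurableSet_singleton _).compl
      (fun x : Rd d => polyFun Q x * gaussWeight x), restrict_compl_singleton]
    rfl
  have h2 := (volume : Measure (Rd d)).measurePreserving_homeomorphUnitSphereProd.integral_comp
    (Homeomorph.measurableEmbedding _) (fun z => polyFun Q (z.1 : Rd d) * g (z.2 : ℝ))
  have h3 : ∀ x : ({0}ᶜ : Set (Rd d)), polyFun Q x.1 * gaussWeight x.1 =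
      polyFun Q ((homeomorphUnitSphereProd (Rd d) x).1 : Rd d) *
        g ((homeomorphUnitSphereProd (Rd d) x).2 : ℝ) := fun x => by
    have hx : (x : Rd d) ≠ 0 := x.2
    have hx' : ‖(x : Rd d)‖ ≠ 0 := norm_ne_zero_iff.2 hx
    simp only [homeomorphUnitSphereProd_apply_fst_coe, homeomorphUnitSphereProd_apply_snd_coe,
      polyFun_smul hQ, gaussWeight, hg]
    have hc : ((‖(x : Rd d)‖ : ℝ) : ℂ) ≠ 0 := by exact_mod_cast hx'
    push_cast
    rw [inv_pow]
    field_simp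
  simp only [h3] at h1
  have h4 := integral_prod_mul (μ := surf d)
    (ν := Measure.volumeIoiPow (Module.finrank ℝ (Rd d) - 1))
    (fun ω : Sph d => polyFun Q (ω : Rd d)) (fun r : Set.Ioi (0 : ℝ) => g r)
  rw [h1, h2, h4, mul_comm, ← integral_radialMoment hd q]
  congr 1
  simp only [Measure.volumeIoiPow, ENNReal.ofReal]
  rw [integral_withDensity_eq_integral_smul
    ((measurable_subtype_coe.pow_const _).real_toNNReal),
    integral_subtype_comap measurableSet_Ioi
      fun a => Real.toNNReal (a ^ (Module.finrank ℝ (Rd d) - 1)) • g a, ← integral_complex_ofReal]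
  refine setIntegral_congr_fun measurableSet_Ioi fun r hr => ?_
  simp only [NNReal.smul_def, Real.coe_toNNReal _ (pow_nonneg (le_of_lt hr) _), hg,
    finrank_euclideanSpace, Fintype.card_fin, Complex.real_smul]
  rw [show q + d - 1 = (d - 1) + q by omega, pow_add]
  push_cast; ring

lemma gaussInt_one : gaussInt (1 : MvPolynomial (Fin d) ℂ) = ((2 * Real.pi) ^ ((d : ℝ) / 2) : ℝ) := by
  have h := GaussianFourier.integral_rexp_neg_mul_sq_norm (V := Rd d) (b := 1 / 2) (by norm_num)
  simp only [gaussInt, polyFun_one, one_mul, gaussWeight]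
  rw [finrank_euclideanSpace, Fintype.card_fin] at h
  rw [integral_complex_ofReal, show 2 * Real.pi = Real.pi / (1 / 2) by ring, ← h]
  congr 2
  ext y
  congr 1; ring

lemma linForm_isHomogeneous (x : Rd d) : (linForm x).IsHomogeneous 1 :=
  MvPolynomial.IsHomogeneous.sum _ _ _ fun i _ => by
    simpa using (MvPolynomial.isHomogeneous_C (Fin d) ((x i : ℝ) : ℂ)).mul
      (MvPolynomial.isHomogeneous_X ℂ i)

/-- The constant in the Funk-Hecke formula for exponentials. -/
noncomputable def funkHeckeConst (d k : ℕ) : ℝ :=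
  (2 * Real.pi) ^ ((d : ℝ) / 2) / (jacobiMoment (k + (d - 1) / 2) 0 * radialMoment d (2 * k))

lemma jacobi_param_pos (hd : 2 ≤ d) (k : ℕ) : 0 < (k + (d - 1) / 2 : ℝ) := by
  have hd' : (2 : ℝ) ≤ d := by exact_mod_cast hd
  have : (0 : ℝ) ≤ k := by positivity
  linarith

lemma jacobiMoment_zero_pos {p : ℝ} (hp : 0 < p) : 0 < jacobiMoment p 0 := by
  rw [jacobiMoment_zero hp]
  have g1 := Real.Gamma_pos_of_pos hp
  have g2 := Real.Gamma_pos_of_pos (by linarith : 0 < p + 1 / 2)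
  have := Real.pi_pos
  positivity

/-- The Gaussian integral of `(x·y)^(k+j) P(y)` is evaluated once by integration by parts and once
in polar coordinates. Exponents below `k` give zero (`sphere_moment_of_lt`), so the exponential
series effectively starts at `k`. -/
lemma sphere_moment (hd : 2 ≤ d) {k : ℕ} {P : MvPolynomial (Fin d) ℂ} (hP : IsHomHarmonic k P)
    {x : Rd d} (hx : ‖x‖ = 1) (j : ℕ) :
    ∫ ω : Sph d, ((inner ℝ x (ω : Rd d) : ℝ) : ℂ) ^ (k + j) * polyFun P ω ∂(surf d) =
      ((k + j).descFactorial k * (funkHeckeConst d k * jacobiMoment (k + (d - 1) / 2) j) : ℝ) *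
        polyFun P x := by
  have h1 := gaussInt_eq_sphere (by omega) (((linForm_isHomogeneous x).pow (k + j)).mul hP.1)
  have h2 := gaussInt_linForm_pow_mul hx (k + j) k P hP
  simp only [polyFun_mul, polyFun_pow, polyFun_linForm] at h1
  rw [h2, gaussInt_one, Nat.add_sub_cancel_left, show 1 * (k + j) + k = 2 * k + j by ring] at h1
  have hr := radialMoment_pos (d := d) (by omega) (2 * k + j)
  have hr2 := radialMoment_pos (d := d) (by omega) (2 * k)
  have hb := jacobiMoment_zero_pos (jacobi_param_pos hd k)
  have h3 := normalMoment_mul_jacobiMoment hd k j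
  have hrc : ((radialMoment d (2 * k + j) : ℝ) : ℂ) ≠ 0 := by exact_mod_cast hr.ne'
  rw [← mul_right_inj' hrc, ← h1, ← mul_assoc, ← Complex.ofReal_mul, ← Complex.ofReal_mul]
  congr 2
  rw [← eq_div_iff (by positivity)] at h3
  rw [funkHeckeConst, h3]
  ring

lemma sphere_moment_of_lt (hd : 2 ≤ d) {k : ℕ} {P : MvPolynomial (Fin d) ℂ}
    (hP : IsHomHarmonic k P) {x : Rd d} (hx : ‖x‖ = 1) {n : ℕ} (hn : n < k) :
    ∫ ω : Sph d, ((inner ℝ x (ω : Rd d) : ℝ) : ℂ) ^ n * polyFun P ω ∂(surf d) = 0 := by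
  have h1 := gaussInt_eq_sphere (by omega) (((linForm_isHomogeneous x).pow n).mul hP.1)
  have h2 := gaussInt_linForm_pow_mul hx n k P hP
  simp only [polyFun_mul, polyFun_pow, polyFun_linForm] at h1
  rw [h2, Nat.descFactorial_eq_zero_iff_lt.2 hn, one_mul] at h1
  have hr := radialMoment_pos (d := d) (by omega) (n + k)
  have hrc : ((radialMoment d (n + k) : ℝ) : ℂ) ≠ 0 := by exact_mod_cast hr.ne'
  simpa only [Nat.cast_zero, zero_mul, Complex.ofReal_zero, zero_eq_mul, hrc, false_or] using h1

/-- Term-by-term integration of an exponential series. -/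
lemma hasSum_integral_exp {α : Type*} [MeasurableSpace α] {μ : Measure α} {a : α → ℝ}
    {f : α → ℂ} (ha : AEStronglyMeasurable a μ) (ha1 : ∀ᵐ x ∂μ, |a x| ≤ 1) (hf : Integrable f μ) (t : ℝ) :
    HasSum (fun n : ℕ => (t : ℂ) ^ n / n.factorial * ∫ x, (a x : ℂ) ^ n * f x ∂μ)
      (∫ x, Complex.exp ((t * a x : ℝ) : ℂ) * f x ∂μ) := by
  have hs : Summable fun n : ℕ => |t| ^ n / n.factorial := Real.summable_pow_div_factorial |t|
  have h := hasSum_integral_of_dominated_convergence (μ := μ)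
    (F := fun (n : ℕ) x => (t : ℂ) ^ n / n.factorial * ((a x : ℂ) ^ n * f x))
    (f := fun x => Complex.exp ((t * a x : ℝ) : ℂ) * f x)
    (fun n x => |t| ^ n / n.factorial * ‖f x‖)
    (fun n => by
      have := (Complex.continuous_ofReal.comp_aestronglyMeasurable ha)
      exact ((this.pow n).mul hf.aestronglyMeasurable).const_mul _)
    (fun n => by
      filter_upwards [ha1] with x hx
      rw [norm_mul, norm_mul, norm_div, norm_pow, norm_pow, Complex.norm_real, Complex.norm_real,
        Complex.norm_natCast, Real.norm_eq_abs, Real.norm_eq_abs]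
      gcongr
      exact mul_le_of_le_one_left (norm_nonneg _) (pow_le_one₀ (abs_nonneg _) hx))
    (ae_of_all _ fun x => hs.mul_right _)
    (by simp only [tsum_mul_right]; exact hf.norm.const_mul _)
    (ae_of_all _ fun x => by
      have := (NormedSpace.expSeries_div_hasSum_exp ((t * a x : ℝ) : ℂ)).mul_right (f x)
      rw [← Complex.exp_eq_exp_ℂ] at this
      refine this.congr_fun ?_
      intro n
      push_cast; rw [mul_pow]; ring)
  simpa only [integral_const_mul] using h

/-- The Funk-Hecke formula for exponentials. -/
lemma funk_hecke_exp (hd : 2 ≤ d) {k : ℕ} {P : MvPolynomial (Fin d) ℂ} (hP : IsHomHarmonic k P)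
    {x : Rd d} (hx : ‖x‖ = 1) (t : ℝ) :
    ∫ ω : Sph d, Complex.exp ((t * inner ℝ x (ω : Rd d) : ℝ) : ℂ) * polyFun P ω ∂(surf d) =
      (funkHeckeConst d k * (t ^ k * ∫ u in Set.Ioo (-1 : ℝ) 1,
        Real.exp (t * u) * jacobiWeight (k + (d - 1) / 2) (k + (d - 1) / 2) u) : ℝ) *
          polyFun P x := by
  set p : ℝ := k + (d - 1) / 2 with hp
  have hp0 : 0 < p := jacobi_param_pos hd k
  have hS := hasSum_integral_exp (μ := surf d) (a := fun ω : Sph d => inner ℝ x (ω : Rd d))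
    (f := fun ω => polyFun P ω)
    (by apply Continuous.aestronglyMeasurable; fun_prop)
    (ae_of_all _ fun ω => by
      have := abs_real_inner_le_norm x (ω : Rd d)
      rwa [hx, norm_eq_of_mem_sphere, one_mul] at this)
    (integrable_sph_of_continuous (continuous_polyFun_sph P)) t
  have hJ := hasSum_integral_exp (μ := volume.restrict (Set.Ioo (-1 : ℝ) 1)) (a := fun u => u)
    (f := fun u => (jacobiWeight p p u : ℂ)) (by apply Continuous.aestronglyMeasurable; fun_prop)
    (ae_restrict_of_forall_mem measurableSet_Ioo fun u hu => abs_le.2 ⟨hu.1.le, hu.2.le⟩)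
    (integrableOn_jacobiWeight hp0 hp0).ofReal t
  have hJ' : HasSum (fun j : ℕ => (t : ℂ) ^ (k + j) / (k + j).factorial *
      ∫ ω : Sph d, ((inner ℝ x (ω : Rd d) : ℝ) : ℂ) ^ (k + j) * polyFun P ω ∂(surf d))
      ((funkHeckeConst d k * (t ^ k * ∫ u in Set.Ioo (-1 : ℝ) 1,
        Real.exp (t * u) * jacobiWeight p p u) : ℝ) * polyFun P x) := by
    have := (hJ.mul_left ((funkHeckeConst d k * t ^ k : ℝ) : ℂ)).mul_right (polyFun P x)
    have e : (((funkHeckeConst d k * t ^ k : ℝ) : ℂ) * ∫ u in Set.Ioo (-1 : ℝ) 1,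
        Complex.exp ((t * u : ℝ) : ℂ) * (jacobiWeight p p u : ℂ)) =
        ((funkHeckeConst d k * (t ^ k * ∫ u in Set.Ioo (-1 : ℝ) 1,
        Real.exp (t * u) * jacobiWeight p p u) : ℝ) : ℂ) := by
      simp only [← Complex.ofReal_exp, ← Complex.ofReal_mul]
      rw [integral_complex_ofReal]
      push_cast; ring
    rw [e] at this
    refine this.congr_fun fun j => ?_
    rw [sphere_moment hd hP hx, ← hp]
    have e2 : ∫ u in Set.Ioo (-1 : ℝ) 1, (u : ℂ) ^ j * (jacobiWeight p p u : ℂ) =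
        (jacobiMoment p j : ℂ) := by
      rw [jacobiMoment, ← integral_complex_ofReal]
      push_cast; rfl
    rw [e2]
    -- The falling factorial from `sphere_moment` reduces `t^(k+j)/(k+j)!` to `t^k · t^j/j!`, so
    -- that the series of `exp(tu)` against the Jacobi weight appears.
    have hf : ((k + j).factorial : ℂ) = j.factorial * (k + j).descFactorial k := by
      have := Nat.factorial_mul_descFactorial (Nat.le_add_right k j)
      rw [Nat.add_sub_cancel_left] at this
      exact_mod_cast this.symm
    have h1 : (j.factorial : ℂ) ≠ 0 := by exact_mod_cast j.factorial_ne_zero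
    have h2 : ((k + j).descFactorial k : ℂ) ≠ 0 := by
      exact_mod_cast (Nat.descFactorial_eq_zero_iff_lt.not.2 (by omega))
    rw [hf]
    push_cast
    rw [pow_add]
    generalize (jacobiMoment p j : ℂ) = J
    field_simp
  refine hS.unique ?_
  -- The index is shifted by `k`; the `k` omitted terms all vanish.
  have := (hasSum_nat_add_iff (f := fun n : ℕ => (t : ℂ) ^ n / n.factorial *
      ∫ ω : Sph d, ((inner ℝ x (ω : Rd d) : ℝ) : ℂ) ^ n * polyFun P ω ∂(surf d)) k).1
    (by simpa only [add_comm _ k] using hJ')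
  rwa [Finset.sum_eq_zero, add_zero] at this
  intro n hn
  rw [sphere_moment_of_lt hd hP hx (Finset.mem_range.1 hn), mul_zero]

end sphere

/-! ### From exponentials to the Riesz kernel: Gamma integrals and the value of the eigenvalue. -/

section kernel
variable {d : ℕ}

lemma integrableOn_rpow_mul_exp_neg_mul {a r : ℝ} (ha : 0 < a) (hr : 0 < r) :
    IntegrableOn (fun t : ℝ => t ^ (a - 1) * Real.exp (-(r * t))) (Set.Ioi 0) := by
  have := integrableOn_rpow_mul_exp_neg_mul_rpow (p := 1) (s := a - 1) (b := r) (by linarith)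
    zero_lt_one hr
  simpa using this

/-- The integrand of the Gamma-Jacobi double integral. -/
lemma integrable_gamma_jacobi {c a b : ℝ} (hc : 0 < c) (ha : c < a) (hb : 0 < b) :
    Integrable (fun z : ℝ × ℝ => z.1 ^ (c - 1) * Real.exp (-((1 - z.2) * z.1)) *
      jacobiWeight a b z.2)
      ((volume.restrict (Set.Ioi (0 : ℝ))).prod (volume.restrict (Set.Ioo (-1 : ℝ) 1))) := by
  have hm := measurable_jacobiWeight a b
  rw [integrable_prod_iff' (by apply Measurable.aestronglyMeasurable; fun_prop)]
  constructor
  · refine ae_restrict_of_forall_mem measurableSet_Ioo fun u hu => ?_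
    exact (integrableOn_rpow_mul_exp_neg_mul (r := 1 - u) hc (by linarith [hu.2])).mul_const
      (jacobiWeight a b u)
  · refine ((integrableOn_jacobiWeight (a := a - c) (b := b) (by linarith) hb).const_mul
      (Real.Gamma c)).congr (ae_restrict_of_forall_mem measurableSet_Ioo fun u hu => ?_)
    have h1 : 0 < 1 - u := by linarith [hu.2]
    have h2 : ∫ t in Set.Ioi (0 : ℝ), ‖t ^ (c - 1) * Real.exp (-((1 - u) * t)) *
        jacobiWeight a b u‖ = ∫ t in Set.Ioi (0 : ℝ), t ^ (c - 1) * Real.exp (-((1 - u) * t)) *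
        jacobiWeight a b u := setIntegral_congr_fun measurableSet_Ioi fun t (ht : 0 < t) => by
      have := jacobiWeight_nonneg a b hu
      exact Real.norm_of_nonneg (by positivity)
    simp only
    rw [h2, integral_mul_const, Real.integral_rpow_mul_exp_neg_mul_Ioi hc h1, jacobiWeight,
      jacobiWeight, one_div, Real.inv_rpow h1.le, ← Real.rpow_neg h1.le,
      show a - c - 1 = -c + (a - 1) by ring, Real.rpow_add h1]
    ring

/-- Integrating in `t` first gives `Γ(c) (1-u)^(-c)`, which lowers the exponent parameter `a` to `a
- c`; this is where `c < a` is needed. -/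
lemma integral_gamma_jacobi {c a b : ℝ} (hc : 0 < c) (ha : c < a) (hb : 0 < b) :
    ∫ t in Set.Ioi (0 : ℝ), ∫ u in Set.Ioo (-1 : ℝ) 1,
      t ^ (c - 1) * Real.exp (-((1 - u) * t)) * jacobiWeight a b u =
      Real.Gamma c * ∫ u in Set.Ioo (-1 : ℝ) 1, jacobiWeight (a - c) b u := by
  rw [integral_integral_swap (integrable_gamma_jacobi hc ha hb), ← integral_const_mul]
  refine setIntegral_congr_fun measurableSet_Ioo fun u hu => ?_
  have h1 : 0 < 1 - u := by linarith [hu.2]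
  rw [integral_mul_const, Real.integral_rpow_mul_exp_neg_mul_Ioi hc h1, jacobiWeight,
      jacobiWeight, one_div, Real.inv_rpow h1.le, ← Real.rpow_neg h1.le,
      show a - c - 1 = -c + (a - 1) by ring, Real.rpow_add h1]
  ring

lemma gamma_mul_exp_integral_eq {c p : ℝ} (k : ℕ) {t : ℝ} (ht : 0 < t) :
    t ^ (c - 1) * Real.exp (-t) * (t ^ k * ∫ u in Set.Ioo (-1 : ℝ) 1,
      Real.exp (t * u) * jacobiWeight p p u) = ∫ u in Set.Ioo (-1 : ℝ) 1,
      t ^ ((c + k) - 1) * Real.exp (-((1 - u) * t)) * jacobiWeight p p u := by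
  rw [← integral_const_mul, ← integral_const_mul]
  congr 1; ext u
  rw [show c + k - 1 = (c - 1) + k by ring, Real.rpow_add ht, Real.rpow_natCast,
    show -((1 - u) * t) = -t + t * u by ring, Real.exp_add]
  ring

lemma isHomHarmonic_one : IsHomHarmonic 0 (1 : MvPolynomial (Fin d) ℂ) :=
  ⟨MvPolynomial.isHomogeneous_one _ _, by simp⟩

/-- The integrand is positive, so its norm can be integrated over the sphere exactly by
`funk_hecke_exp` with `P = 1`. This reduces the claim to `integrable_gamma_jacobi` with both
parameters `(d-1)/2`. -/
lemma integrable_gamma_sphere (hd : 2 ≤ d) {c : ℝ} (hc : 0 < c) (hc' : c < ((d : ℝ) - 1) / 2)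
    {x : Rd d} (hx : ‖x‖ = 1) :
    Integrable (fun z : ℝ × Sph d => z.1 ^ (c - 1) * Real.exp (-z.1) *
      Real.exp (z.1 * inner ℝ x (z.2 : Rd d)))
      ((volume.restrict (Set.Ioi (0 : ℝ))).prod (surf d)) := by
  rw [integrable_prod_iff (by apply Measurable.aestronglyMeasurable; fun_prop)]
  constructor
  · refine ae_of_all _ fun t => ?_
    simp only
    exact (integrable_sph_of_continuous (by fun_prop)).const_mul _
  · have h := ((integrable_gamma_jacobi (c := c) (a := (d - 1) / 2) (b := (d - 1) / 2) hc hc'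
      (by linarith)).integral_prod_left).const_mul (funkHeckeConst d 0)
    refine h.congr (ae_restrict_of_forall_mem measurableSet_Ioi fun t (ht : 0 < t) => ?_)
    have h2 := funk_hecke_exp hd isHomHarmonic_one hx t
    simp only [polyFun_one, mul_one, ← Complex.ofReal_exp] at h2
    rw [integral_complex_ofReal, Complex.ofReal_inj] at h2
    have h3 : ∀ ω : Sph d, ‖t ^ (c - 1) * Real.exp (-t) * Real.exp (t * inner ℝ x (ω : Rd d))‖ =
        t ^ (c - 1) * Real.exp (-t) * Real.exp (t * inner ℝ x (ω : Rd d)) := fun ω =>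
      Real.norm_of_nonneg (by positivity)
    simp only [h3]
    rw [integral_const_mul, h2]
    have h4 := gamma_mul_exp_integral_eq (c := c) (p := ((0 : ℕ) : ℝ) + ((d : ℝ) - 1) / 2) 0 ht
    simp only [Nat.cast_zero, zero_add, add_zero] at h4 ⊢
    rw [← h4]; ring

lemma integral_gamma_fiber {c : ℝ} (hc : 0 < c) {v : ℝ} (hv : v ≤ 1) :
    ∫ t in Set.Ioi (0 : ℝ), t ^ (c - 1) * Real.exp (-t) * Real.exp (t * v) =
      Real.Gamma c * (1 - v) ^ (-c) := by
  have e : ∀ t : ℝ, t ^ (c - 1) * Real.exp (-t) * Real.exp (t * v) =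
      t ^ (c - 1) * Real.exp (-((1 - v) * t)) := fun t => by
    rw [mul_assoc, ← Real.exp_add]; ring_nf
  simp only [e]
  rcases hv.lt_or_eq with hv | rfl
  · have h1 : 0 < 1 - v := by linarith
    rw [Real.integral_rpow_mul_exp_neg_mul_Ioi hc h1, one_div, Real.inv_rpow h1.le,
      ← Real.rpow_neg h1.le, mul_comm]
  -- At `v = 1` both sides are zero by default values: `t^(c-1)` is not integrable on the half line,
  -- and `0^(-c) = 0`.
  · simp only [sub_self, zero_mul, neg_zero, Real.exp_zero, mul_one,
      Real.zero_rpow (neg_ne_zero.2 hc.ne'), mul_zero]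
    exact integral_undef (not_integrableOn_Ioi_rpow _)

lemma inner_sph_le_one {x : Rd d} (hx : ‖x‖ = 1) (ω : Sph d) : inner ℝ x (ω : Rd d) ≤ 1 := by
  have := real_inner_le_norm x (ω : Rd d)
  rwa [hx, norm_eq_of_mem_sphere, one_mul] at this

/-- By Fubini almost every `ω` has an integrable fibre in `t`, whereas the fibre at `ω = x` is
`t^(c-1)`. The choice `c = 1/4` is admissible since `(d-1)/2 ≥ 1/2`. -/
lemma surf_ae_ne (hd : 2 ≤ d) (x : Sph d) : ∀ᵐ ω ∂(surf d), ω ≠ x := by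
  have hd' : (2 : ℝ) ≤ d := by exact_mod_cast hd
  have h := (integrable_gamma_sphere (c := 1 / 4) hd (by norm_num) (by linarith)
    (norm_eq_of_mem_sphere x)).prod_left_ae
  filter_upwards [h] with ω hω heq
  rw [heq] at hω
  refine not_integrableOn_Ioi_rpow (1 / 4 - 1) (hω.congr (ae_of_all _ fun t => ?_))
  simp only [real_inner_self_eq_norm_sq, norm_eq_of_mem_sphere]
  rw [mul_assoc, ← Real.exp_add]; simp

lemma integrable_one_sub_inner_rpow (hd : 2 ≤ d) {c : ℝ} (hc : 0 < c)
    (hc' : c < ((d : ℝ) - 1) / 2) {x : Rd d} (hx : ‖x‖ = 1) :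
    Integrable (fun ω : Sph d => (1 - inner ℝ x (ω : Rd d)) ^ (-c)) (surf d) := by
  have h := (integrable_gamma_sphere hd hc hc' hx).integral_prod_right
  simp only [integral_gamma_fiber hc (inner_sph_le_one hx _)] at h
  exact (integrable_const_mul_iff (Real.Gamma_pos_of_pos hc).ne'.isUnit _).1 h

/-- The Funk-Hecke formula for the kernels `(1 - x · ω)^(-c)`. -/
lemma funk_hecke_rpow (hd : 2 ≤ d) {c : ℝ} (hc : 0 < c) (hc' : c < ((d : ℝ) - 1) / 2) {k : ℕ}
    {P : MvPolynomial (Fin d) ℂ} (hP : IsHomHarmonic k P) {x : Rd d} (hx : ‖x‖ = 1) :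
    ∫ ω : Sph d, (((1 - inner ℝ x (ω : Rd d)) ^ (-c) : ℝ) : ℂ) * polyFun P ω ∂(surf d) =
      (funkHeckeConst d k * (Real.Gamma (c + k) / Real.Gamma c) * ∫ u in Set.Ioo (-1 : ℝ) 1,
        jacobiWeight ((d - 1) / 2 - c) (k + (d - 1) / 2) u : ℝ) * polyFun P x := by
  have hg := Real.Gamma_pos_of_pos hc
  have hk : (0 : ℝ) ≤ k := by positivity
  have hI : Integrable (fun z : ℝ × Sph d => ((z.1 ^ (c - 1) * Real.exp (-z.1) *
      Real.exp (z.1 * inner ℝ x (z.2 : Rd d)) : ℝ) : ℂ) * polyFun P z.2)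
      ((volume.restrict (Set.Ioi (0 : ℝ))).prod (surf d)) := by
    obtain ⟨C, hC⟩ := isCompact_univ.exists_bound_of_continuousOn (s := Set.univ)
      (continuous_polyFun_sph P).continuousOn
    refine (integrable_gamma_sphere hd hc hc' hx).ofReal.mul_bdd (c := C) ?_
      (ae_of_all _ fun z => hC z.2 (Set.mem_univ _))
    exact ((continuous_polyFun_sph P).comp continuous_snd).aestronglyMeasurable
  have h1 := integral_integral_swap (f := fun (t : ℝ) (ω : Sph d) => ((t ^ (c - 1) * Real.exp (-t) *
      Real.exp (t * inner ℝ x (ω : Rd d)) : ℝ) : ℂ) * polyFun P (ω : Rd d)) hI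
  have h2 : ∀ ω : Sph d, ∫ t in Set.Ioi (0 : ℝ), ((t ^ (c - 1) * Real.exp (-t) *
      Real.exp (t * inner ℝ x (ω : Rd d)) : ℝ) : ℂ) * polyFun P (ω : Rd d) =
      Real.Gamma c * ((((1 - inner ℝ x (ω : Rd d)) ^ (-c) : ℝ) : ℂ) * polyFun P ω) := fun ω => by
    rw [integral_mul_const, integral_complex_ofReal,
      integral_gamma_fiber hc (inner_sph_le_one hx ω)]
    push_cast; ring
  -- In this order the sphere integral comes first and is given by `funk_hecke_exp`. Its factor
  -- `t^k` shifts `c` to `c + k`, while the first Jacobi parameter `k + (d-1)/2 - (c+k)` no longer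
  -- depends on `k`.
  have h3 : ∫ t in Set.Ioi (0 : ℝ), ∫ ω : Sph d, ((t ^ (c - 1) * Real.exp (-t) *
      Real.exp (t * inner ℝ x (ω : Rd d)) : ℝ) : ℂ) * polyFun P (ω : Rd d) ∂(surf d) =
      (funkHeckeConst d k * (Real.Gamma (c + k) * ∫ u in Set.Ioo (-1 : ℝ) 1,
        jacobiWeight ((d - 1) / 2 - c) (k + (d - 1) / 2) u) : ℝ) * polyFun P x := by
    have e := integral_gamma_jacobi (c := c + k) (a := k + (d - 1) / 2) (b := k + (d - 1) / 2)
      (by linarith) (by linarith) (by linarith)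
    rw [show (k : ℝ) + (d - 1) / 2 - (c + k) = (d - 1) / 2 - c by ring] at e
    rw [← e, ← integral_const_mul, ← integral_complex_ofReal, ← integral_mul_const]
    refine setIntegral_congr_fun measurableSet_Ioi fun t (ht : 0 < t) => ?_
    rw [← gamma_mul_exp_integral_eq k ht]
    have h4 := funk_hecke_exp hd hP hx t
    simp only [Complex.ofReal_mul _ (Real.exp _), mul_assoc _ _ (polyFun P _)]
    rw [integral_const_mul]
    simp only [Complex.ofReal_exp (_ * inner ℝ x _), h4]
    push_cast; ring
  rw [h3] at h1
  simp only [h2] at h1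
  rw [integral_const_mul] at h1
  have hgc : (Real.Gamma c : ℂ) ≠ 0 := by exact_mod_cast hg.ne'
  rw [← mul_right_inj' hgc, ← h1]
  push_cast
  field_simp

/-- The kernel of `S S*`: the Riesz kernel of `(-Δ)^(-s)`. -/
noncomputable def rieszConst (d : ℕ) (s : ℝ) : ℝ :=
  Real.Gamma ((d : ℝ) / 2 - s) / (4 ^ s * Real.pi ^ ((d : ℝ) / 2) * Real.Gamma s)

/-- The Riesz kernel restricted to the sphere. -/
noncomputable def rieszKernel (s : ℝ) (x y : Sph d) : ℝ :=
  rieszConst d s * ‖(x : Rd d) - y‖ ^ (2 * s - d)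

lemma rieszConst_pos {s : ℝ} (hs : 1 / 2 < s) (hs' : s < (d : ℝ) / 2) : 0 < rieszConst d s := by
  have h1 := Real.Gamma_pos_of_pos (by linarith : 0 < (d : ℝ) / 2 - s)
  have h2 := Real.Gamma_pos_of_pos (by linarith : 0 < s)
  have := Real.pi_pos
  unfold rieszConst; positivity

lemma rieszKernel_symm (s : ℝ) (x y : Sph d) : rieszKernel s x y = rieszKernel s y x := by
  rw [rieszKernel, rieszKernel, norm_sub_rev]

lemma rieszKernel_nonneg {s : ℝ} (hs : 1 / 2 < s) (hs' : s < (d : ℝ) / 2) (x y : Sph d) :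
    0 ≤ rieszKernel s x y := by
  have := rieszConst_pos hs hs'
  unfold rieszKernel; positivity

lemma rieszKernel_pos {s : ℝ} (hs : 1 / 2 < s) (hs' : s < (d : ℝ) / 2) {x y : Sph d}
    (hxy : x ≠ y) : 0 < rieszKernel s x y := by
  have := rieszConst_pos hs hs'
  have h : 0 < ‖(x : Rd d) - y‖ := norm_pos_iff.2 (sub_ne_zero.2 fun h => hxy (Subtype.ext h))
  unfold rieszKernel; positivity

lemma measurable_rieszKernel (s : ℝ) :
    Measurable (fun z : Sph d × Sph d => rieszKernel s z.1 z.2) := by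
  unfold rieszKernel; fun_prop

/-- On the unit sphere `|x-y|² = 2(1 - x·y)`, so the Funk-Hecke formula applies with `c = d/2 - s`.
-/
lemma rieszKernel_eq (s : ℝ) (x y : Sph d) : rieszKernel s x y =
    rieszConst d s * 2 ^ (-((d : ℝ) / 2 - s)) *
      (1 - inner ℝ (x : Rd d) (y : Rd d)) ^ (-((d : ℝ) / 2 - s)) := by
  have h1 : 0 ≤ 1 - inner ℝ (x : Rd d) (y : Rd d) := by
    linarith [inner_sph_le_one (norm_eq_of_mem_sphere x) y]
  have h2 : ‖(x : Rd d) - y‖ ^ 2 = 2 * (1 - inner ℝ (x : Rd d) (y : Rd d)) := by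
    rw [norm_sub_sq_real, norm_eq_of_mem_sphere, norm_eq_of_mem_sphere]; ring
  rw [rieszKernel, mul_assoc, ← Real.mul_rpow zero_le_two h1, ← h2, ← Real.rpow_natCast,
    ← Real.rpow_mul (norm_nonneg _)]
  congr 2; push_cast; ring

/-- For `c = d/2 - s` the conditions `0 < c < (d-1)/2` are exactly `1/2 < s < d/2`. -/
lemma integrable_rieszKernel (hd : 2 ≤ d) {s : ℝ} (hs : 1 / 2 < s) (hs' : s < (d : ℝ) / 2)
    (x : Sph d) : Integrable (rieszKernel s x) (surf d) := by
  have h := integrable_one_sub_inner_rpow (c := (d : ℝ) / 2 - s) hd (by linarith) (by linarith)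
    (norm_eq_of_mem_sphere x)
  refine (h.const_mul (rieszConst d s * 2 ^ (-((d : ℝ) / 2 - s)))).congr
    (ae_of_all _ fun y => (rieszKernel_eq s x y).symm)

/-- The integral is a beta value with parameters `s - 1/2` and `k + (d-1)/2`. Duplication turns
`Γ(s-1/2)` into a multiple of `Γ(2s-1)/Γ(s)`; this `Γ(s)` and the one in `rieszConst` make up the
square in `λ_k`. -/
lemma traceEigenvalue_eq (hd : 2 ≤ d) {s : ℝ} (hs : 1 / 2 < s) (hs' : s < (d : ℝ) / 2) (k : ℕ) :
    rieszConst d s * 2 ^ (-((d : ℝ) / 2 - s)) *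
      (funkHeckeConst d k * (Real.Gamma ((d : ℝ) / 2 - s + k) / Real.Gamma ((d : ℝ) / 2 - s)) *
        ∫ u in Set.Ioo (-1 : ℝ) 1,
          jacobiWeight ((d - 1) / 2 - ((d : ℝ) / 2 - s)) (k + (d - 1) / 2) u) =
      traceEigenvalue d s k := by
  have hd' : (2 : ℝ) ≤ d := by exact_mod_cast hd
  have hk : (0 : ℝ) ≤ k := by positivity
  have hp := jacobi_param_pos hd k
  rw [show ((d : ℝ) - 1) / 2 - ((d : ℝ) / 2 - s) = s - 1 / 2 by ring,
    integral_jacobiWeight (by linarith) hp, funkHeckeConst, jacobiMoment_zero hp, radialMoment,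
    rieszConst, traceEigenvalue,
    show s - 1 / 2 + (k + ((d : ℝ) - 1) / 2) = k + (d : ℝ) / 2 - 1 + s by ring,
    show (k + ((d : ℝ) - 1) / 2) + 1 / 2 = k + (d : ℝ) / 2 by ring,
    show ((2 * k + d : ℕ) : ℝ) / 2 = k + (d : ℝ) / 2 by push_cast; ring,
    show (d : ℝ) / 2 - s + k = k + (d : ℝ) / 2 - s by ring]
  have dup := Real.Gamma_mul_Gamma_add_half (s - 1 / 2)
  rw [show s - 1 / 2 + 1 / 2 = s by ring, show 2 * (s - 1 / 2) = 2 * s - 1 by ring,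
    show 1 - (2 * s - 1) = 2 - 2 * s by ring] at dup
  have g1 := Real.Gamma_pos_of_pos hp
  have g2 := Real.Gamma_pos_of_pos (by linarith : 0 < k + (d : ℝ) / 2)
  have g3 := Real.Gamma_pos_of_pos (by linarith : 0 < k + (d : ℝ) / 2 - s)
  have g4 := Real.Gamma_pos_of_pos (by linarith : 0 < (d : ℝ) / 2 - s)
  have g5 := Real.Gamma_pos_of_pos (by linarith : 0 < s)
  have g6 := Real.Gamma_pos_of_pos (by linarith : 0 < k + (d : ℝ) / 2 - 1 + s)
  have hpi := Real.pi_pos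
  rw [Real.mul_rpow zero_le_two hpi.le]
  have e : Real.Gamma (s - 1 / 2) = Real.Gamma (2 * s - 1) * 2 ^ (2 - 2 * s) * √Real.pi /
      Real.Gamma s := by rw [eq_div_iff g5.ne', dup]
  rw [e]
  -- Gamma values and powers become free symbols, so that the claim is a rational identity modulo
  -- the single relation `h2` between powers of two.
  generalize Real.Gamma (k + ((d : ℝ) - 1) / 2) = G1 at *
  generalize Real.Gamma (k + (d : ℝ) / 2) = G2 at *
  generalize Real.Gamma (k + (d : ℝ) / 2 - s) = G3 at *
  generalize Real.Gamma ((d : ℝ) / 2 - s) = G4 at *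
  generalize Real.Gamma s = G5 at *
  generalize Real.Gamma (k + (d : ℝ) / 2 - 1 + s) = G6 at *
  generalize Real.Gamma (2 * s - 1) = G7 at *
  have hq : 0 < √Real.pi := Real.sqrt_pos.2 hpi
  have hpd : 0 < Real.pi ^ ((d : ℝ) / 2) := by positivity
  generalize √Real.pi = q at *
  generalize Real.pi ^ ((d : ℝ) / 2) = w at *
  have h4 : (4 : ℝ) ^ s = 2 ^ (2 * s) := by
    rw [Real.rpow_mul zero_le_two]; norm_num
  have h2 : (2 : ℝ) ^ (-((d : ℝ) / 2 - s)) * 2 ^ ((d : ℝ) / 2) * 2 ^ (2 - 2 * s) *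
      2 ^ (k + (d : ℝ) / 2 - 1 + s - 1) =
      2 ^ (1 - 2 * s) * 2 ^ (2 * s) * 2 ^ (k + (d : ℝ) / 2 - 1) := by
    simp only [← Real.rpow_add two_pos]
    congr 1; ring
  have p1 : (0 : ℝ) < 2 ^ (2 * s) := by positivity
  have p2 : (0 : ℝ) < 2 ^ (k + (d : ℝ) / 2 - 1) := by positivity
  rw [h4]
  generalize (2 : ℝ) ^ (-((d : ℝ) / 2 - s)) = a1 at *
  generalize (2 : ℝ) ^ ((d : ℝ) / 2) = a2 at *
  generalize (2 : ℝ) ^ (2 - 2 * s) = a3 at *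
  generalize (2 : ℝ) ^ (k + (d : ℝ) / 2 - 1 + s - 1) = a4 at *
  generalize (2 : ℝ) ^ (1 - 2 * s) = a5 at *
  generalize (2 : ℝ) ^ (2 * s) = a6 at *
  generalize (2 : ℝ) ^ (k + (d : ℝ) / 2 - 1) = a7 at *
  field_simp
  linear_combination G7 * h2

/-- The Funk-Hecke formula for the Riesz kernel. -/
lemma integral_rieszKernel_mul (hd : 2 ≤ d) {s : ℝ} (hs : 1 / 2 < s) (hs' : s < (d : ℝ) / 2)
    {k : ℕ} {P : MvPolynomial (Fin d) ℂ} (hP : IsHomHarmonic k P) (x : Sph d) :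
    ∫ ω : Sph d, (rieszKernel s x ω : ℂ) * polyFun P ω ∂(surf d) =
      (traceEigenvalue d s k : ℂ) * polyFun P x := by
  have h := funk_hecke_rpow (c := (d : ℝ) / 2 - s) hd (by linarith) (by linarith) hP
    (norm_eq_of_mem_sphere x)
  have e : ∀ ω : Sph d, (rieszKernel s x ω : ℂ) * polyFun P (ω : Rd d) =
      ((rieszConst d s * 2 ^ (-((d : ℝ) / 2 - s)) : ℝ) : ℂ) *
        ((((1 - inner ℝ (x : Rd d) (ω : Rd d)) ^ (-((d : ℝ) / 2 - s)) : ℝ) : ℂ) *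
          polyFun P ω) := fun ω => by
    rw [rieszKernel_eq]; push_cast; ring
  simp only [e]
  rw [integral_const_mul, h, ← mul_assoc, ← Complex.ofReal_mul, traceEigenvalue_eq hd hs hs']

lemma integral_rieszKernel (hd : 2 ≤ d) {s : ℝ} (hs : 1 / 2 < s) (hs' : s < (d : ℝ) / 2)
    (x : Sph d) : ∫ ω : Sph d, rieszKernel s x ω ∂(surf d) = traceEigenvalue d s 0 := by
  have h := integral_rieszKernel_mul hd hs hs' (isHomHarmonic_one (d := d)) x
  simp only [polyFun_one, mul_one] at h
  rw [integral_complex_ofReal] at h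
  exact_mod_cast h

end kernel

/-! ### Extensions of sphere densities tested against Gaussians; the heat kernel. -/

section fourier
variable {d : ℕ}

lemma integrable_L2Sph (G : L2Sph d) : Integrable G (surf d) :=
  (Lp.memLp G).integrable one_le_two

lemma integrable_sq_L2Sph (G : L2Sph d) : Integrable (fun x => ‖G x‖ ^ 2) (surf d) :=
  (Lp.memLp G).integrable_norm_pow two_ne_zero

lemma measurable_L2Sph (G : L2Sph d) : Measurable G := (Lp.stronglyMeasurable G).measurable

lemma norm_exp_neg_I_mul (r : ℝ) : ‖Complex.exp (-Complex.I * (r : ℂ))‖ = 1 := by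
  rw [Complex.norm_exp]; simp

lemma norm_extensionOp_le (G : L2Sph d) (ξ : Rd d) :
    ‖extensionOp G ξ‖ ≤ ∫ ω, ‖G ω‖ ∂(surf d) := by
  refine (norm_integral_le_integral_norm _).trans_eq ?_
  simp only [norm_mul, norm_exp_neg_I_mul, one_mul]

lemma continuous_extensionOp (G : L2Sph d) : Continuous (extensionOp G) := by
  refine continuous_of_dominated (bound := fun ω => ‖G ω‖) (fun ξ => ?_) (fun ξ => ?_)
    (integrable_L2Sph G).norm ?_
  · have := measurable_L2Sph G
    apply Measurable.aestronglyMeasurable; fun_prop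
  · exact ae_of_all _ fun ω => by rw [norm_mul, norm_exp_neg_I_mul, one_mul]
  · exact ae_of_all _ fun ω => by fun_prop

/-- The extension operator with the Fourier normalization of Mathlib. -/
noncomputable def sphFourier (G : L2Sph d) (ξ : Rd d) : ℂ := extensionOp G ((2 * Real.pi) • ξ)

lemma continuous_sphFourier (G : L2Sph d) : Continuous (sphFourier G) :=
  (continuous_extensionOp G).comp (continuous_const_smul _)

/-- The heat kernel `(4πt)^(-d/2) exp (-‖z‖² / (4t))`. -/
noncomputable def heatKernel (t : ℝ) (z : Rd d) : ℝ :=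
  (4 * Real.pi * t) ^ (-((d : ℝ) / 2)) * Real.exp (-(‖z‖ ^ 2 / (4 * t)))

lemma heatKernel_nonneg {t : ℝ} (ht : 0 < t) (z : Rd d) : 0 ≤ heatKernel t z := by
  have := Real.pi_pos
  unfold heatKernel; positivity

lemma measurable_heatKernel : Measurable (fun z : ℝ × Rd d => heatKernel z.1 z.2) := by
  unfold heatKernel; fun_prop

lemma integral_gaussian_phase {t : ℝ} (ht : 0 < t) (z : Rd d) :
    ∫ ξ : Rd d, (Real.exp (-(t * ‖(2 * Real.pi) • ξ‖ ^ 2)) : ℂ) *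
      Complex.exp (Complex.I * ((inner ℝ z ((2 * Real.pi) • ξ) : ℝ) : ℂ)) = (heatKernel t z : ℂ) := by
  have hpi := Real.pi_pos
  have hb : 0 < 4 * Real.pi ^ 2 * t := by positivity
  have h := GaussianFourier.integral_cexp_neg_mul_sq_norm_add (V := Rd d)
    (b := ((4 * Real.pi ^ 2 * t : ℝ) : ℂ)) (by simpa only [Complex.ofReal_re] using hb)
    (2 * Real.pi * Complex.I) z
  have e : ∀ ξ : Rd d, (Real.exp (-(t * ‖(2 * Real.pi) • ξ‖ ^ 2)) : ℂ) *
      Complex.exp (Complex.I * ((inner ℝ z ((2 * Real.pi) • ξ) : ℝ) : ℂ)) =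
      Complex.exp (-((4 * Real.pi ^ 2 * t : ℝ) : ℂ) * (‖ξ‖ : ℂ) ^ 2 +
        2 * Real.pi * Complex.I * ((inner ℝ z ξ : ℝ) : ℂ)) := fun ξ => by
    rw [Complex.ofReal_exp, ← Complex.exp_add, norm_smul, inner_smul_right,
      Real.norm_of_nonneg (by positivity)]
    congr 1; push_cast; ring
  simp only [e]
  rw [h, heatKernel, finrank_euclideanSpace, Fintype.card_fin,
    Complex.ofReal_mul (_ ^ _), Complex.ofReal_exp]
  congr 1
  · rw [Real.rpow_neg (by positivity), ← Real.inv_rpow (by positivity),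
      Complex.ofReal_cpow (by positivity)]
    congr 1
    · push_cast; field_simp
    · push_cast; rfl
  · congr 1
    have : (Real.pi : ℂ) ≠ 0 := by exact_mod_cast hpi.ne'
    have : (t : ℂ) ≠ 0 := by exact_mod_cast ht.ne'
    push_cast
    field_simp
    rw [Complex.I_sq]; ring

/-- The product density `conj H(x) G(y)`. -/
noncomputable def tensor (H G : L2Sph d) (z : Sph d × Sph d) : ℂ :=
  starRingEnd ℂ (H z.1) * G z.2

lemma measurable_tensor (H G : L2Sph d) : Measurable (tensor H G) := by
  have h1 := measurable_L2Sph H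
  have h2 := measurable_L2Sph G
  unfold tensor
  exact (Complex.continuous_conj.measurable.comp (h1.comp measurable_fst)).mul
    (h2.comp measurable_snd)

lemma norm_tensor (H G : L2Sph d) (z : Sph d × Sph d) : ‖tensor H G z‖ = ‖H z.1‖ * ‖G z.2‖ := by
  simp [tensor]

lemma integrable_tensor (H G : L2Sph d) :
    Integrable (tensor H G) ((surf d).prod (surf d)) := by
  refine (integrable_norm_iff (measurable_tensor H G).aestronglyMeasurable).1 ?_
  simp only [norm_tensor]
  exact (integrable_L2Sph H).norm.mul_prod (integrable_L2Sph G).norm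

lemma conj_extensionOp_mul (H G : L2Sph d) (η : Rd d) :
    starRingEnd ℂ (extensionOp H η) * extensionOp G η =
      ∫ z : Sph d × Sph d, tensor H G z *
        Complex.exp (Complex.I * ((inner ℝ ((z.1 : Rd d) - (z.2 : Rd d)) η : ℝ) : ℂ))
          ∂((surf d).prod (surf d)) := by
  rw [extensionOp, extensionOp, ← integral_conj, ← integral_prod_mul]
  congr 1; ext z
  have e : Complex.exp (Complex.I * ((inner ℝ ((z.1 : Rd d) - (z.2 : Rd d)) η : ℝ) : ℂ)) =
      starRingEnd ℂ (Complex.exp (-Complex.I * ((inner ℝ (z.1 : Rd d) η : ℝ) : ℂ))) *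
        Complex.exp (-Complex.I * ((inner ℝ (z.2 : Rd d) η : ℝ) : ℂ)) := by
    rw [← Complex.exp_conj, ← Complex.exp_add, inner_sub_left]
    simp only [map_mul, map_neg, Complex.conj_I, Complex.conj_ofReal]
    congr 1; push_cast; ring
  rw [e, tensor, map_mul]
  ring

lemma integrable_gaussian {t : ℝ} (ht : 0 < t) :
    Integrable (fun ξ : Rd d => Real.exp (-(t * ‖(2 * Real.pi) • ξ‖ ^ 2))) := by
  have hpi := Real.pi_pos
  have hb : 0 < 4 * Real.pi ^ 2 * t := by positivity
  have := (GaussianFourier.integrable_cexp_neg_mul_sq_norm_add (V := Rd d)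
    (b := ((4 * Real.pi ^ 2 * t : ℝ) : ℂ)) (by simpa only [Complex.ofReal_re] using hb) 0 0).norm
  refine this.congr (ae_of_all _ fun ξ => ?_)
  simp only [Complex.norm_exp, norm_smul, Real.norm_of_nonneg (by positivity : 0 ≤ 2 * Real.pi)]
  congr 1
  simp [← Complex.ofReal_pow, ← Complex.ofReal_mul]
  ring_nf

/-- Pairing of extensions against a Gaussian. -/
lemma integral_gaussian_sphFourier {t : ℝ} (ht : 0 < t) (H G : L2Sph d) :
    ∫ ξ : Rd d, (Real.exp (-(t * ‖(2 * Real.pi) • ξ‖ ^ 2)) : ℂ) *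
      (starRingEnd ℂ (sphFourier H ξ) * sphFourier G ξ) =
      ∫ z : Sph d × Sph d, (heatKernel t ((z.1 : Rd d) - (z.2 : Rd d)) : ℂ) * tensor H G z
        ∂((surf d).prod (surf d)) := by
  simp only [sphFourier, conj_extensionOp_mul]
  simp only [← integral_const_mul]
  have hT := measurable_tensor H G
  rw [integral_integral_swap]
  · congr 1; ext z
    rw [← integral_gaussian_phase ht, ← integral_mul_const]
    congr 1; ext ξ; ring
  · refine (integrable_norm_iff ?_).1 ?_
    · apply Measurable.aestronglyMeasurable
      unfold Function.uncurry
      fun_prop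
    · refine ((integrable_gaussian ht).mul_prod (integrable_tensor H G).norm).congr
        (ae_of_all _ fun z => ?_)
      simp only [Function.uncurry, norm_mul]
      rw [Complex.norm_real, Real.norm_of_nonneg (Real.exp_pos _).le, mul_comm Complex.I,
        Complex.norm_exp_ofReal_mul_I, mul_one]

lemma integrable_gaussian_sphFourier {t : ℝ} (ht : 0 < t) (H G : L2Sph d) :
    Integrable (fun ξ : Rd d => (Real.exp (-(t * ‖(2 * Real.pi) • ξ‖ ^ 2)) : ℂ) *
      (starRingEnd ℂ (sphFourier H ξ) * sphFourier G ξ)) := by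
  refine (integrable_gaussian ht).ofReal.mul_bdd
    (c := (∫ ω, ‖H ω‖ ∂(surf d)) * ∫ ω, ‖G ω‖ ∂(surf d)) ?_ (ae_of_all _ fun ξ => ?_)
  · exact ((Complex.continuous_conj.comp (continuous_sphFourier H)).mul
      (continuous_sphFourier G)).aestronglyMeasurable
  · rw [norm_mul, RCLike.norm_conj]
    exact mul_le_mul (norm_extensionOp_le _ _) (norm_extensionOp_le _ _) (norm_nonneg _)
      (integral_nonneg fun _ => norm_nonneg _)

/-- Integration in time of the heat kernel gives the Riesz kernel. -/
lemma heat_time_integral {s r : ℝ} (hs' : s < (d : ℝ) / 2) (hr : 0 < r) :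
    IntegrableOn (fun t : ℝ => t ^ (s - 1) * ((4 * Real.pi * t) ^ (-((d : ℝ) / 2)) *
      Real.exp (-(r ^ 2 / (4 * t))))) (Set.Ioi 0) ∧
    ∫ t in Set.Ioi (0 : ℝ), t ^ (s - 1) * ((4 * Real.pi * t) ^ (-((d : ℝ) / 2)) *
      Real.exp (-(r ^ 2 / (4 * t)))) =
      Real.Gamma ((d : ℝ) / 2 - s) / (4 ^ s * Real.pi ^ ((d : ℝ) / 2)) * r ^ (2 * s - d) := by
  set f : ℝ → ℝ := fun t => t ^ (s - 1) * ((4 * Real.pi * t) ^ (-((d : ℝ) / 2)) *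
      Real.exp (-(r ^ 2 / (4 * t)))) with hf
  have hpi := Real.pi_pos
  have hc : 0 < (d : ℝ) / 2 - s := by linarith
  have hb : 0 < r ^ 2 / 4 := by positivity
  -- The substitution `t = u⁻¹` leads to a Gamma integral with parameter `d/2 - s`.
  have e : ∀ u ∈ Set.Ioi (0 : ℝ), (|(-1 : ℝ)| * u ^ ((-1 : ℝ) - 1)) • f (u ^ (-1 : ℝ)) =
      (4 * Real.pi) ^ (-((d : ℝ) / 2)) *
        (u ^ ((d : ℝ) / 2 - s - 1) * Real.exp (-(r ^ 2 / 4 * u))) := fun u (hu : 0 < u) => by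
    have e1 : (u ^ (-1 : ℝ)) ^ (s - 1) = u ^ (1 - s) := by
      rw [← Real.rpow_mul hu.le]; ring_nf
    have e2 : (4 * Real.pi * u ^ (-1 : ℝ)) ^ (-((d : ℝ) / 2)) =
        (4 * Real.pi) ^ (-((d : ℝ) / 2)) * u ^ ((d : ℝ) / 2) := by
      rw [Real.mul_rpow (by positivity) (by positivity), ← Real.rpow_mul hu.le]; ring_nf
    have e3 : r ^ 2 / (4 * u ^ (-1 : ℝ)) = r ^ 2 / 4 * u := by
      rw [Real.rpow_neg_one]; field_simp
    have e4 : u ^ ((d : ℝ) / 2 - s - 1) = u ^ ((-1 : ℝ) - 1) * u ^ (1 - s) * u ^ ((d : ℝ) / 2) := by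
      rw [← Real.rpow_add hu, ← Real.rpow_add hu]; ring_nf
    simp only [hf, smul_eq_mul, e1, e2, e3, e4, abs_neg, abs_one]
    ring
  constructor
  · rw [← integrableOn_Ioi_comp_rpow_iff f (p := -1) (by norm_num),
      integrableOn_congr_fun e measurableSet_Ioi]
    exact (integrableOn_rpow_mul_exp_neg_mul hc hb).const_mul _
  · rw [← integral_comp_rpow_Ioi f (p := -1) (by norm_num),
      setIntegral_congr_fun measurableSet_Ioi e, integral_const_mul,
      Real.integral_rpow_mul_exp_neg_mul_Ioi hc hb]
    have e5 : (1 / (r ^ 2 / 4)) ^ ((d : ℝ) / 2 - s) =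
        4 ^ ((d : ℝ) / 2) / 4 ^ s * r ^ (2 * s - d) := by
      rw [one_div_div, Real.div_rpow (by norm_num) (by positivity), Real.rpow_sub (by norm_num),
        div_eq_mul_inv _ ((r ^ 2) ^ _), ← Real.rpow_neg (by positivity), ← Real.rpow_natCast,
        ← Real.rpow_mul hr.le]
      congr 2; push_cast; ring
    rw [e5, Real.mul_rpow (by norm_num) hpi.le, Real.rpow_neg (by norm_num), Real.rpow_neg hpi.le]
    have : (0 : ℝ) < 4 ^ ((d : ℝ) / 2) := by positivity
    field_simp

end fourier

/-! ### The quadratic form of the extension operator as a Riesz energy. -/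

section pairing
variable {d : ℕ} {s : ℝ}

lemma surf_prod_ae_ne (hd : 2 ≤ d) : ∀ᵐ z ∂((surf d).prod (surf d)), z.1 ≠ z.2 := by
  rw [Measure.ae_prod_iff_ae_ae (p := fun z : Sph d × Sph d => z.1 ≠ z.2)
    (measurableSet_eq_fun measurable_fst measurable_snd).compl]
  exact ae_of_all _ fun x => (surf_ae_ne hd x).mono fun y hy => hy.symm

lemma traceEigenvalue_pos (hs : 1 / 2 < s) (hs' : s < (d : ℝ) / 2) (k : ℕ) :
    0 < traceEigenvalue d s k := by
  have hk : (0 : ℝ) ≤ k := by positivity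
  have h1 := Real.Gamma_pos_of_pos (by linarith : 0 < 2 * s - 1)
  have h2 := Real.Gamma_pos_of_pos (by linarith : 0 < k + (d : ℝ) / 2 - s)
  have h3 := Real.Gamma_pos_of_pos (by linarith : 0 < s)
  have h4 := Real.Gamma_pos_of_pos (by linarith : 0 < k + (d : ℝ) / 2 - 1 + s)
  unfold traceEigenvalue; positivity

lemma integrable_rieszKernel_mul_fst (hd : 2 ≤ d) (hs : 1 / 2 < s) (hs' : s < (d : ℝ) / 2)
    {f : Sph d → ℝ} (hf : Measurable f) (hfi : Integrable f (surf d)) :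
    Integrable (fun z : Sph d × Sph d => rieszKernel s z.1 z.2 * f z.1)
      ((surf d).prod (surf d)) := by
  have hm := measurable_rieszKernel (d := d) s
  rw [integrable_prod_iff (by apply Measurable.aestronglyMeasurable; fun_prop)]
  constructor
  · exact ae_of_all _ fun x => (integrable_rieszKernel hd hs hs' x).mul_const (f x)
  · refine (hfi.norm.const_mul (traceEigenvalue d s 0)).congr (ae_of_all _ fun x => ?_)
    simp only [norm_mul]
    rw [integral_mul_const, ← integral_rieszKernel hd hs hs' x]
    congr 2; ext y
    exact (Real.norm_of_nonneg (rieszKernel_nonneg hs hs' x y)).symm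

lemma integral_rieszKernel_mul_fst (hd : 2 ≤ d) (hs : 1 / 2 < s) (hs' : s < (d : ℝ) / 2)
    {f : Sph d → ℝ} (hf : Measurable f) (hfi : Integrable f (surf d)) :
    ∫ z : Sph d × Sph d, rieszKernel s z.1 z.2 * f z.1 ∂((surf d).prod (surf d)) =
      traceEigenvalue d s 0 * ∫ x, f x ∂(surf d) := by
  rw [integral_prod _ (integrable_rieszKernel_mul_fst hd hs hs' hf hfi), ← integral_const_mul]
  simp only [integral_mul_const, integral_rieszKernel hd hs hs']

lemma integrable_rieszKernel_mul_snd (hd : 2 ≤ d) (hs : 1 / 2 < s) (hs' : s < (d : ℝ) / 2)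
    {f : Sph d → ℝ} (hf : Measurable f) (hfi : Integrable f (surf d)) :
    Integrable (fun z : Sph d × Sph d => rieszKernel s z.1 z.2 * f z.2)
      ((surf d).prod (surf d)) := by
  have h := (integrable_rieszKernel_mul_fst hd hs hs' hf hfi).swap
  refine h.congr (ae_of_all _ fun z => ?_)
  simp only [Function.comp, Prod.fst_swap, Prod.snd_swap]
  rw [rieszKernel_symm]

lemma integral_rieszKernel_mul_snd (hd : 2 ≤ d) (hs : 1 / 2 < s) (hs' : s < (d : ℝ) / 2)
    {f : Sph d → ℝ} (hf : Measurable f) (hfi : Integrable f (surf d)) :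
    ∫ z : Sph d × Sph d, rieszKernel s z.1 z.2 * f z.2 ∂((surf d).prod (surf d)) =
      traceEigenvalue d s 0 * ∫ x, f x ∂(surf d) := by
  rw [← integral_rieszKernel_mul_fst hd hs hs' hf hfi, ← integral_prod_swap]
  congr 1; ext z
  simp only [Prod.fst_swap, Prod.snd_swap]
  rw [rieszKernel_symm]

/-- A Schur test: `|H(x) G(y)| ≤ |H(x)|² + |G(y)|²`, and the kernel has the finite integral `λ_0` in
either variable. -/
lemma integrable_rieszKernel_tensor (hd : 2 ≤ d) (hs : 1 / 2 < s) (hs' : s < (d : ℝ) / 2)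
    (H G : L2Sph d) :
    Integrable (fun z : Sph d × Sph d => (rieszKernel s z.1 z.2 : ℂ) * tensor H G z)
      ((surf d).prod (surf d)) := by
  have h1 := integrable_rieszKernel_mul_fst hd hs hs'
    ((measurable_L2Sph H).norm.pow_const 2) (integrable_sq_L2Sph H)
  have h2 := integrable_rieszKernel_mul_snd hd hs hs'
    ((measurable_L2Sph G).norm.pow_const 2) (integrable_sq_L2Sph G)
  have hm := measurable_rieszKernel (d := d) s
  have hT := measurable_tensor H G
  refine (h1.add h2).mono' (by apply Measurable.aestronglyMeasurable; fun_prop)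
    (ae_of_all _ fun z => ?_)
  have hK := rieszKernel_nonneg hs hs' z.1 z.2
  rw [norm_mul, norm_tensor, Complex.norm_real, Real.norm_of_nonneg hK]
  simp only [Pi.add_apply, ← mul_add]
  refine mul_le_mul_of_nonneg_left ?_ hK
  nlinarith [sq_nonneg (‖H z.1‖ - ‖G z.2‖), sq_nonneg ‖H z.1‖, sq_nonneg ‖G z.2‖]

lemma heat_fiber (hs : 1 / 2 < s) (hs' : s < (d : ℝ) / 2) {x y : Sph d} (hxy : x ≠ y) :
    IntegrableOn (fun t : ℝ => t ^ (s - 1) * heatKernel t ((x : Rd d) - (y : Rd d)))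
      (Set.Ioi 0) ∧
    ∫ t in Set.Ioi (0 : ℝ), t ^ (s - 1) * heatKernel t ((x : Rd d) - (y : Rd d)) =
      Real.Gamma s * rieszKernel s x y := by
  have hr : 0 < ‖(x : Rd d) - y‖ := norm_pos_iff.2 (sub_ne_zero.2 fun h => hxy (Subtype.ext h))
  have h := heat_time_integral hs' hr
  refine ⟨h.1, h.2.trans ?_⟩
  have := Real.Gamma_pos_of_pos (by linarith : 0 < s)
  have := Real.pi_pos
  rw [rieszKernel, rieszConst]
  field_simp

lemma integrable_heat_tensor (hd : 2 ≤ d) (hs : 1 / 2 < s) (hs' : s < (d : ℝ) / 2)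
    (H G : L2Sph d) :
    Integrable (fun w : ℝ × (Sph d × Sph d) =>
      ((w.1 ^ (s - 1) * heatKernel w.1 ((w.2.1 : Rd d) - (w.2.2 : Rd d)) : ℝ) : ℂ) *
        tensor H G w.2)
      ((volume.restrict (Set.Ioi (0 : ℝ))).prod ((surf d).prod (surf d))) := by
  have hT := measurable_tensor H G
  have hk : Measurable fun w : ℝ × (Sph d × Sph d) =>
      heatKernel w.1 ((w.2.1 : Rd d) - (w.2.2 : Rd d)) :=
    measurable_heatKernel.comp (by fun_prop :
      Measurable fun w : ℝ × (Sph d × Sph d) => (w.1, (w.2.1 : Rd d) - (w.2.2 : Rd d)))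
  rw [integrable_prod_iff' (by apply Measurable.aestronglyMeasurable; fun_prop)]
  constructor
  · filter_upwards [surf_prod_ae_ne hd] with z hz
    exact (heat_fiber hs hs' hz).1.ofReal.mul_const (tensor H G z)
  · refine ((integrable_rieszKernel_tensor hd hs hs' H G).norm.const_mul (Real.Gamma s)).congr ?_
    filter_upwards [surf_prod_ae_ne hd] with z hz
    have e : ∀ t ∈ Set.Ioi (0 : ℝ),
        ‖((t ^ (s - 1) * heatKernel t ((z.1 : Rd d) - (z.2 : Rd d)) : ℝ) : ℂ) * tensor H G z‖ =
        t ^ (s - 1) * heatKernel t ((z.1 : Rd d) - (z.2 : Rd d)) * ‖tensor H G z‖ :=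
      fun t (ht : 0 < t) => by
        have := heatKernel_nonneg ht ((z.1 : Rd d) - (z.2 : Rd d))
        rw [norm_mul, Complex.norm_real, Real.norm_of_nonneg (by positivity)]
    rw [setIntegral_congr_fun measurableSet_Ioi e, integral_mul_const, (heat_fiber hs hs' hz).2,
      norm_mul, Complex.norm_real, Real.norm_of_nonneg (rieszKernel_nonneg hs hs' z.1 z.2)]
    ring

lemma integral_heat_tensor (hd : 2 ≤ d) (hs : 1 / 2 < s) (hs' : s < (d : ℝ) / 2)
    (H G : L2Sph d) :
    ∫ t in Set.Ioi (0 : ℝ), ((t ^ (s - 1) : ℝ) : ℂ) * (∫ z : Sph d × Sph d,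
      (heatKernel t ((z.1 : Rd d) - (z.2 : Rd d)) : ℂ) * tensor H G z
        ∂((surf d).prod (surf d))) =
      Real.Gamma s * ∫ z : Sph d × Sph d, (rieszKernel s z.1 z.2 : ℂ) * tensor H G z
        ∂((surf d).prod (surf d)) := by
  have h := integral_integral_swap (f := fun (t : ℝ) (z : Sph d × Sph d) =>
    ((t ^ (s - 1) * heatKernel t ((z.1 : Rd d) - (z.2 : Rd d)) : ℝ) : ℂ) * tensor H G z)
    (integrable_heat_tensor hd hs hs' H G)
  simp only [← integral_const_mul]
  simp only [Complex.ofReal_mul, mul_assoc] at h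
  rw [h]
  refine integral_congr_ae ?_
  filter_upwards [surf_prod_ae_ne hd] with z hz
  simp only [← mul_assoc, ← Complex.ofReal_mul]
  rw [integral_mul_const, integral_complex_ofReal, (heat_fiber hs hs' hz).2]

lemma gauss_fiber (hs : 1 / 2 < s) {ξ : Rd d} (hξ : ξ ≠ 0) :
    IntegrableOn (fun t : ℝ => t ^ (s - 1) * Real.exp (-(t * ‖(2 * Real.pi) • ξ‖ ^ 2)))
      (Set.Ioi 0) ∧
    ∫ t in Set.Ioi (0 : ℝ), t ^ (s - 1) * Real.exp (-(t * ‖(2 * Real.pi) • ξ‖ ^ 2)) =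
      Real.Gamma s * (‖(2 * Real.pi) • ξ‖ ^ (-s)) ^ 2 := by
  have hr : 0 < ‖(2 * Real.pi) • ξ‖ :=
    norm_pos_iff.2 (smul_ne_zero (by positivity) hξ)
  have hs0 : 0 < s := by linarith
  have hr2 : 0 < ‖(2 * Real.pi) • ξ‖ ^ 2 := by positivity
  simp only [mul_comm _ (‖(2 * Real.pi) • ξ‖ ^ 2)]
  refine ⟨integrableOn_rpow_mul_exp_neg_mul hs0 hr2, ?_⟩
  rw [Real.integral_rpow_mul_exp_neg_mul_Ioi hs0 hr2, mul_comm, one_div,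
    Real.inv_rpow hr2.le, ← Real.rpow_neg hr2.le, ← Real.rpow_natCast, ← Real.rpow_natCast,
    ← Real.rpow_mul hr.le, ← Real.rpow_mul hr.le]
  congr 2; ring

/-- For `H = G` the integrand is nonnegative, so the ξ-integral of its norm is the norm of its
ξ-integral. By `integral_gaussian_sphFourier` the latter is a heat kernel pairing, whose
integrability in `t` is known from the sphere side. This is why `|ξ|^(-s) (G dσ)^` is square
integrable. -/
lemma integrable_gauss_sphFourier_self (hd : 2 ≤ d) (hs : 1 / 2 < s) (hs' : s < (d : ℝ) / 2)
    (G : L2Sph d) :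
    Integrable (fun w : ℝ × Rd d =>
      ((w.1 ^ (s - 1) * Real.exp (-(w.1 * ‖(2 * Real.pi) • w.2‖ ^ 2)) : ℝ) : ℂ) *
        (starRingEnd ℂ (sphFourier G w.2) * sphFourier G w.2))
      ((volume.restrict (Set.Ioi (0 : ℝ))).prod volume) := by
  have hc := (continuous_sphFourier G).measurable
  have hcc := (Complex.continuous_conj.comp (continuous_sphFourier G)).measurable
  simp only [Function.comp_def] at hcc
  rw [integrable_prod_iff (by apply Measurable.aestronglyMeasurable; fun_prop)]
  constructor
  · refine ae_restrict_of_forall_mem measurableSet_Ioi fun t (ht : 0 < t) => ?_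
    simp only [Complex.ofReal_mul, mul_assoc]
    exact (integrable_gaussian_sphFourier ht G G).const_mul _
  · refine (integrable_heat_tensor hd hs hs' G G).integral_prod_left.norm.congr
      (ae_restrict_of_forall_mem measurableSet_Ioi fun t (ht : 0 < t) => ?_)
    simp only [Complex.ofReal_mul, mul_assoc]
    have e : ∀ ξ : Rd d, ((t ^ (s - 1) : ℝ) : ℂ) *
        ((Real.exp (-(t * ‖(2 * Real.pi) • ξ‖ ^ 2)) : ℂ) *
          (starRingEnd ℂ (sphFourier G ξ) * sphFourier G ξ)) =
        ((t ^ (s - 1) * (Real.exp (-(t * ‖(2 * Real.pi) • ξ‖ ^ 2)) *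
          ‖sphFourier G ξ‖ ^ 2) : ℝ) : ℂ) := fun ξ => by
      rw [mul_comm (starRingEnd ℂ _), Complex.mul_conj, Complex.normSq_eq_norm_sq]; push_cast; rfl
    rw [integral_const_mul, ← integral_gaussian_sphFourier ht, ← integral_const_mul]
    simp only [e]
    rw [integral_complex_ofReal, Complex.norm_real]
    simp only [Complex.norm_real]
    have e2 : ∀ ξ : Rd d, 0 ≤ t ^ (s - 1) * (Real.exp (-(t * ‖(2 * Real.pi) • ξ‖ ^ 2)) *
          ‖sphFourier G ξ‖ ^ 2) := fun ξ => by positivity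
    simp only [Real.norm_of_nonneg (e2 _)]
    exact Real.norm_of_nonneg (integral_nonneg e2)

lemma integrable_gauss_sphFourier (hd : 2 ≤ d) (hs : 1 / 2 < s) (hs' : s < (d : ℝ) / 2)
    (H G : L2Sph d) :
    Integrable (fun w : ℝ × Rd d =>
      ((w.1 ^ (s - 1) * Real.exp (-(w.1 * ‖(2 * Real.pi) • w.2‖ ^ 2)) : ℝ) : ℂ) *
        (starRingEnd ℂ (sphFourier H w.2) * sphFourier G w.2))
      ((volume.restrict (Set.Ioi (0 : ℝ))).prod volume) := by
  have hc := (continuous_sphFourier G).measurable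
  have hcc := (Complex.continuous_conj.comp (continuous_sphFourier H)).measurable
  simp only [Function.comp_def] at hcc
  have hm : Measurable fun w : ℝ × Rd d => starRingEnd ℂ (sphFourier H w.2) * sphFourier G w.2 :=
    (hcc.comp measurable_snd).mul (hc.comp measurable_snd)
  refine ((integrable_gauss_sphFourier_self hd hs hs' H).norm.add
    (integrable_gauss_sphFourier_self hd hs hs' G).norm).mono'
    (by apply Measurable.aestronglyMeasurable; fun_prop) (ae_of_all _ fun w => ?_)
  simp only [Pi.add_apply, norm_mul, RCLike.norm_conj, ← mul_add]
  refine mul_le_mul_of_nonneg_left ?_ (by positivity)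
  nlinarith [sq_nonneg (‖sphFourier H w.2‖ - ‖sphFourier G w.2‖),
    sq_nonneg ‖sphFourier H w.2‖, sq_nonneg ‖sphFourier G w.2‖]

/-- The multiplier `|2πξ|^(-s)` applied to the extension of `G`. -/
noncomputable def extSymbol (s : ℝ) (G : L2Sph d) (ξ : Rd d) : ℂ :=
  ((‖(2 * Real.pi) • ξ‖ ^ (-s) : ℝ) : ℂ) * sphFourier G ξ

lemma gauss_fiber_pairing (hs : 1 / 2 < s) (H G : L2Sph d) {ξ : Rd d} (hξ : ξ ≠ 0) :
    ∫ t in Set.Ioi (0 : ℝ), ((t ^ (s - 1) * Real.exp (-(t * ‖(2 * Real.pi) • ξ‖ ^ 2)) : ℝ) : ℂ) *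
        (starRingEnd ℂ (sphFourier H ξ) * sphFourier G ξ) =
      Real.Gamma s * (starRingEnd ℂ (extSymbol s H ξ) * extSymbol s G ξ) := by
  rw [integral_mul_const, integral_complex_ofReal, (gauss_fiber hs hξ).2, extSymbol, extSymbol,
    map_mul, Complex.conj_ofReal]
  push_cast; ring

/-- The quadratic form of `S S*` in terms of the Riesz kernel. -/
lemma extSymbol_pairing (hd : 2 ≤ d) (hs : 1 / 2 < s) (hs' : s < (d : ℝ) / 2) (H G : L2Sph d) :
    Integrable (fun ξ => starRingEnd ℂ (extSymbol s H ξ) * extSymbol s G ξ) ∧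
    ∫ ξ, starRingEnd ℂ (extSymbol s H ξ) * extSymbol s G ξ =
      ∫ z : Sph d × Sph d, (rieszKernel s z.1 z.2 : ℂ) * tensor H G z
        ∂((surf d).prod (surf d)) := by
  have := nontrivial_Rd (by omega : 0 < d)
  have hg : ((Real.Gamma s : ℝ) : ℂ) ≠ 0 := by
    exact_mod_cast (Real.Gamma_pos_of_pos (by linarith : 0 < s)).ne'
  have h0 : ∀ᵐ ξ : Rd d, ξ ≠ 0 := Measure.ae_ne volume 0
  have hI := integrable_gauss_sphFourier hd hs hs' H G
  constructor
  · have h := hI.integral_prod_right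
    refine (integrable_const_mul_iff hg.isUnit _).1 (h.congr ?_)
    filter_upwards [h0] with ξ hξ
    exact gauss_fiber_pairing hs H G hξ
  · rw [← mul_right_inj' hg, ← integral_heat_tensor hd hs hs', ← integral_const_mul]
    have h := integral_integral_swap (f := fun (t : ℝ) (ξ : Rd d) =>
      ((t ^ (s - 1) * Real.exp (-(t * ‖(2 * Real.pi) • ξ‖ ^ 2)) : ℝ) : ℂ) *
        (starRingEnd ℂ (sphFourier H ξ) * sphFourier G ξ)) hI
    rw [integral_congr_ae (h0.mono fun ξ hξ => gauss_fiber_pairing hs H G hξ)] at h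
    rw [← h]
    refine setIntegral_congr_fun measurableSet_Ioi fun t (ht : 0 < t) => ?_
    rw [← integral_gaussian_sphFourier ht, ← integral_const_mul]
    simp only [Complex.ofReal_mul, mul_assoc]

end pairing

/-! ### Monotonicity and decay of the eigenvalues. -/

section eigenvalue
variable {d : ℕ} {s : ℝ}

lemma traceEigenvalue_succ_mul (hs : 1 / 2 < s) (hs' : s < (d : ℝ) / 2) (k : ℕ) :
    traceEigenvalue d s (k + 1) * (k + (d : ℝ) / 2 - 1 + s) =
      traceEigenvalue d s k * (k + (d : ℝ) / 2 - s) := by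
  have hk : (0 : ℝ) ≤ k := by positivity
  have h1 : 0 < k + (d : ℝ) / 2 - s := by linarith
  have h2 : 0 < k + (d : ℝ) / 2 - 1 + s := by linarith
  have g2 := Real.Gamma_pos_of_pos h2
  have g3 := Real.Gamma_pos_of_pos (by linarith : 0 < s)
  rw [traceEigenvalue, traceEigenvalue,
    show ((k + 1 : ℕ) : ℝ) + (d : ℝ) / 2 - s = (k + (d : ℝ) / 2 - s) + 1 by push_cast; ring,
    show ((k + 1 : ℕ) : ℝ) + (d : ℝ) / 2 - 1 + s = (k + (d : ℝ) / 2 - 1 + s) + 1 by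
      push_cast; ring,
    Real.Gamma_add_one h1.ne', Real.Gamma_add_one h2.ne']
  generalize Real.Gamma (k + (d : ℝ) / 2 - 1 + s) = G at *
  generalize (k : ℝ) + (d : ℝ) / 2 - 1 + s = b at *
  field_simp

/-- Consecutive eigenvalues have ratio `(k + d/2 - s)/(k + d/2 - 1 + s)`, which is below one because
`s > 1/2`. -/
lemma strictAnti_traceEigenvalue (hs : 1 / 2 < s) (hs' : s < (d : ℝ) / 2) :
    StrictAnti (traceEigenvalue d s) := by
  refine strictAnti_nat_of_succ_lt fun k => ?_
  have hk : (0 : ℝ) ≤ k := by positivity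
  have h := traceEigenvalue_succ_mul hs hs' k
  have h0 := traceEigenvalue_pos hs hs' k
  have h2 : 0 < k + (d : ℝ) / 2 - 1 + s := by linarith
  refine lt_of_mul_lt_mul_right (h.trans_lt ?_) h2.le
  exact mul_lt_mul_of_pos_left (by linarith) h0

lemma Gamma_add_nat_eq_prod {a : ℝ} (ha : 0 < a) (n : ℕ) :
    Real.Gamma (n + a) = Real.Gamma a * ∏ j ∈ Finset.range n, (a + j) := by
  induction n with
  | zero => simp
  | succ n ih =>
    have h : (n : ℝ) + a ≠ 0 := by positivity
    rw [Finset.prod_range_succ, ← mul_assoc, ← ih, Nat.cast_succ,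
      show (n : ℝ) + 1 + a = (n + a) + 1 by ring, Real.Gamma_add_one h]
    ring

/-- Euler's limit formula for `Γ(a)` and `Γ(b)` shows that the ratio decays like `n^(-(b-a))`. -/
lemma tendsto_Gamma_ratio {a b : ℝ} (ha : 0 < a) (hab : a < b) :
    Tendsto (fun n : ℕ => Real.Gamma (n + a) / Real.Gamma (n + b)) atTop (𝓝 0) := by
  have hb : 0 < b := ha.trans hab
  have ga := Real.Gamma_pos_of_pos ha
  have gb := Real.Gamma_pos_of_pos hb
  -- The product in `Real.GammaSeq` has `n + 1` factors, hence the shift.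
  rw [← tendsto_add_atTop_iff_nat 1]
  have h1 := (Real.GammaSeq_tendsto_Gamma b).div (Real.GammaSeq_tendsto_Gamma a) ga.ne'
  have h2 : Tendsto (fun n : ℕ => (n : ℝ) ^ (-(b - a))) atTop (𝓝 0) :=
    (tendsto_rpow_neg_atTop (by linarith)).comp tendsto_natCast_atTop_atTop
  have h3 := (h1.mul h2).const_mul (Real.Gamma a / Real.Gamma b)
  rw [mul_zero, mul_zero] at h3
  refine h3.congr' ?_
  filter_upwards [eventually_gt_atTop 0] with n hn
  have hn' : (0 : ℝ) < n := by exact_mod_cast hn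
  have pa : 0 < ∏ j ∈ Finset.range (n + 1), (a + j) := Finset.prod_pos fun j _ => by positivity
  have pb : 0 < ∏ j ∈ Finset.range (n + 1), (b + j) := Finset.prod_pos fun j _ => by positivity
  have hf : (0 : ℝ) < n.factorial := by exact_mod_cast n.factorial_pos
  have e : (n : ℝ) ^ b * (n : ℝ) ^ (-(b - a)) = (n : ℝ) ^ a := by
    rw [← Real.rpow_add hn']; ring_nf
  have hna : (0 : ℝ) < (n : ℝ) ^ a := by positivity
  simp only [Pi.div_apply]
  rw [Gamma_add_nat_eq_prod ha, Gamma_add_nat_eq_prod hb, Real.GammaSeq, Real.GammaSeq]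
  field_simp
  rw [e]

lemma tendsto_traceEigenvalue (hs : 1 / 2 < s) (hs' : s < (d : ℝ) / 2) :
    Tendsto (traceEigenvalue d s) atTop (𝓝 0) := by
  have h := (tendsto_Gamma_ratio (a := (d : ℝ) / 2 - s) (b := (d : ℝ) / 2 - 1 + s)
    (by linarith) (by linarith)).const_mul
      ((2 : ℝ) ^ (1 - 2 * s) * (Real.Gamma (2 * s - 1) / Real.Gamma s ^ 2))
  rw [mul_zero] at h
  refine h.congr fun k => ?_
  rw [traceEigenvalue, show (k : ℝ) + ((d : ℝ) / 2 - s) = k + (d : ℝ) / 2 - s by ring,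
    show (k : ℝ) + ((d : ℝ) / 2 - 1 + s) = k + (d : ℝ) / 2 - 1 + s by ring, mul_div_mul_comm,
    mul_assoc]

end eigenvalue

/-! ### The adjoint as a bounded operator, the sharp bound and its equality case. -/

section operator
variable {d : ℕ} {s : ℝ}

lemma memLp_extSymbol (hd : 2 ≤ d) (hs : 1 / 2 < s) (hs' : s < (d : ℝ) / 2) (G : L2Sph d) :
    MemLp (extSymbol s G) 2 := by
  have hc := (continuous_sphFourier G).measurable
  have hm : AEStronglyMeasurable (extSymbol s G) := by
    unfold extSymbol
    apply Measurable.aestronglyMeasurable; fun_prop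
  rw [memLp_two_iff_integrable_sq_norm hm]
  refine (extSymbol_pairing hd hs hs' G G).1.norm.congr (ae_of_all _ fun ξ => ?_)
  simp [sq]

/-- The element `|2πξ|^(-s) (G dσ)^` of `L²`. -/
noncomputable def symbolLp (hd : 2 ≤ d) (hs : 1 / 2 < s) (hs' : s < (d : ℝ) / 2) (G : L2Sph d) :
    L2Rd d := (memLp_extSymbol hd hs hs' G).toLp _

lemma coeFn_symbolLp (hd : 2 ≤ d) (hs : 1 / 2 < s) (hs' : s < (d : ℝ) / 2) (G : L2Sph d) :
    symbolLp hd hs hs' G =ᵐ[volume] extSymbol s G := MemLp.coeFn_toLp _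

lemma extensionOp_add (G H : L2Sph d) (ξ : Rd d) :
    extensionOp (G + H) ξ = extensionOp G ξ + extensionOp H ξ := by
  have hi : ∀ F : L2Sph d, Integrable (fun ω : Sph d =>
      Complex.exp (-Complex.I * ((inner ℝ (ω : Rd d) ξ : ℝ) : ℂ)) * F ω) (surf d) := fun F =>
    (integrable_L2Sph F).bdd_mul (c := 1)
      (by apply Continuous.aestronglyMeasurable; fun_prop)
      (ae_of_all _ fun ω => (norm_exp_neg_I_mul _).le)
  rw [extensionOp, extensionOp, extensionOp, ← integral_add (hi G) (hi H)]
  refine integral_congr_ae ?_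
  filter_upwards [Lp.coeFn_add G H] with ω h
  rw [h, Pi.add_apply, mul_add]

lemma extensionOp_smul (c : ℂ) (G : L2Sph d) (ξ : Rd d) :
    extensionOp (c • G) ξ = c * extensionOp G ξ := by
  rw [extensionOp, extensionOp, ← integral_const_mul]
  refine integral_congr_ae ?_
  filter_upwards [Lp.coeFn_smul c G] with ω h
  rw [h, Pi.smul_apply, smul_eq_mul]; ring

lemma symbolLp_add (hd : 2 ≤ d) (hs : 1 / 2 < s) (hs' : s < (d : ℝ) / 2) (G H : L2Sph d) :
    symbolLp hd hs hs' (G + H) = symbolLp hd hs hs' G + symbolLp hd hs hs' H := by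
  rw [symbolLp, symbolLp, symbolLp, ← MemLp.toLp_add]
  congr 1; ext ξ
  simp only [Pi.add_apply, extSymbol, sphFourier, extensionOp_add, mul_add]

lemma symbolLp_smul (hd : 2 ≤ d) (hs : 1 / 2 < s) (hs' : s < (d : ℝ) / 2) (c : ℂ) (G : L2Sph d) :
    symbolLp hd hs hs' (c • G) = c • symbolLp hd hs hs' G := by
  rw [symbolLp, symbolLp, ← MemLp.toLp_const_smul]
  congr 1; ext ξ
  simp only [Pi.smul_apply, smul_eq_mul, extSymbol, sphFourier, extensionOp_smul]; ring

lemma inner_symbolLp (hd : 2 ≤ d) (hs : 1 / 2 < s) (hs' : s < (d : ℝ) / 2) (H G : L2Sph d) :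
    inner ℂ (symbolLp hd hs hs' H) (symbolLp hd hs hs' G) =
      ∫ z : Sph d × Sph d, (rieszKernel s z.1 z.2 : ℂ) * tensor H G z
        ∂((surf d).prod (surf d)) := by
  rw [← (extSymbol_pairing hd hs hs' H G).2, L2.inner_def]
  refine integral_congr_ae ?_
  filter_upwards [coeFn_symbolLp hd hs hs' H, coeFn_symbolLp hd hs hs' G] with ξ h1 h2
  rw [h1, h2, RCLike.inner_apply, mul_comm]

lemma norm_sq_L2Sph (G : L2Sph d) : ‖G‖ ^ 2 = ∫ x, ‖G x‖ ^ 2 ∂(surf d) := by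
  have h : ((‖G‖ ^ 2 : ℝ) : ℂ) = ((∫ x, ‖G x‖ ^ 2 ∂(surf d) : ℝ) : ℂ) := by
    have := inner_self_eq_norm_sq_to_K (𝕜 := ℂ) G
    rw [L2.inner_def] at this
    rw [← integral_complex_ofReal]
    push_cast
    refine this.symm.trans (integral_congr_ae (ae_of_all _ fun x => ?_))
    simp only
    rw [inner_self_eq_norm_sq_to_K]
    rfl
  exact_mod_cast h

/-- The defect in the bound for the quadratic form is a Dirichlet-type form. -/
lemma dirichlet_form_eq (hd : 2 ≤ d) (hs : 1 / 2 < s) (hs' : s < (d : ℝ) / 2) (G : L2Sph d) :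
    Integrable (fun z : Sph d × Sph d => rieszKernel s z.1 z.2 * ‖G z.1 - G z.2‖ ^ 2)
      ((surf d).prod (surf d)) ∧
    ∫ z : Sph d × Sph d, rieszKernel s z.1 z.2 * ‖G z.1 - G z.2‖ ^ 2
        ∂((surf d).prod (surf d)) =
      2 * (traceEigenvalue d s 0 * ‖G‖ ^ 2 - ‖symbolLp hd hs hs' G‖ ^ 2) := by
  have hm := (measurable_L2Sph G).norm.pow_const 2
  have h1 := integrable_rieszKernel_mul_fst hd hs hs' hm (integrable_sq_L2Sph G)
  have h2 := integrable_rieszKernel_mul_snd hd hs hs' hm (integrable_sq_L2Sph G)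
  have h3 := (integrable_rieszKernel_tensor hd hs hs' G G).re
  have e : ∀ z : Sph d × Sph d, rieszKernel s z.1 z.2 * ‖G z.1 - G z.2‖ ^ 2 =
      rieszKernel s z.1 z.2 * ‖G z.1‖ ^ 2 + rieszKernel s z.1 z.2 * ‖G z.2‖ ^ 2 -
        2 * RCLike.re ((rieszKernel s z.1 z.2 : ℂ) * tensor G G z) := fun z => by
    have : RCLike.re ((rieszKernel s z.1 z.2 : ℂ) * tensor G G z) =
        rieszKernel s z.1 z.2 * RCLike.re (inner ℂ (G z.1) (G z.2)) := by
      rw [tensor, RCLike.inner_apply, mul_comm (G z.2)]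
      exact Complex.re_ofReal_mul _ _
    rw [this, @norm_sub_sq ℂ]
    ring
  have h4 : ‖symbolLp hd hs hs' G‖ ^ 2 = ∫ z : Sph d × Sph d,
      RCLike.re ((rieszKernel s z.1 z.2 : ℂ) * tensor G G z) ∂((surf d).prod (surf d)) := by
    rw [integral_re (integrable_rieszKernel_tensor hd hs hs' G G), ← inner_symbolLp hd hs hs',
      inner_self_eq_norm_sq]
  simp only [e]
  refine ⟨(h1.add h2).sub (h3.const_mul 2), ?_⟩
  have h5 := integral_sub (h1.add h2) (h3.const_mul 2)
  simp only [Pi.add_apply] at h5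
  rw [h5, integral_add h1 h2, integral_const_mul,
    integral_rieszKernel_mul_fst hd hs hs' hm (integrable_sq_L2Sph G),
    integral_rieszKernel_mul_snd hd hs hs' hm (integrable_sq_L2Sph G), ← norm_sq_L2Sph, h4]
  ring

lemma norm_symbolLp_sq_le (hd : 2 ≤ d) (hs : 1 / 2 < s) (hs' : s < (d : ℝ) / 2) (G : L2Sph d) :
    ‖symbolLp hd hs hs' G‖ ^ 2 ≤ traceEigenvalue d s 0 * ‖G‖ ^ 2 := by
  have h := (dirichlet_form_eq hd hs hs' G).2
  have : 0 ≤ ∫ z : Sph d × Sph d, rieszKernel s z.1 z.2 * ‖G z.1 - G z.2‖ ^ 2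
        ∂((surf d).prod (surf d)) := integral_nonneg fun z => by
    have := rieszKernel_nonneg hs hs' z.1 z.2
    positivity
  linarith

/-- Equality forces the Dirichlet form to vanish. The kernel is positive off the null diagonal, so
`G(x) = G(y)` for almost every pair, and a generic slice `x` supplies the constant. -/
lemma norm_symbolLp_sq_eq_iff (hd : 2 ≤ d) (hs : 1 / 2 < s) (hs' : s < (d : ℝ) / 2)
    (G : L2Sph d) :
    ‖symbolLp hd hs hs' G‖ ^ 2 = traceEigenvalue d s 0 * ‖G‖ ^ 2 ↔
      ∃ c : ℂ, G =ᵐ[surf d] fun _ => c := by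
  have := nontrivial_Rd (by omega : 0 < d)
  have hne : surf d ≠ 0 := Measure.toSphere_ne_zero _
  obtain ⟨hi, h⟩ := dirichlet_form_eq hd hs hs' G
  have h0 : ‖symbolLp hd hs hs' G‖ ^ 2 = traceEigenvalue d s 0 * ‖G‖ ^ 2 ↔
      (fun z : Sph d × Sph d => rieszKernel s z.1 z.2 * ‖G z.1 - G z.2‖ ^ 2)
        =ᵐ[(surf d).prod (surf d)] 0 := by
    rw [← integral_eq_zero_iff_of_nonneg (fun z => by
      have := rieszKernel_nonneg hs hs' z.1 z.2
      simp only [Pi.zero_apply]; positivity) hi, h]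
    constructor <;> intro h' <;> linarith
  rw [h0]
  constructor
  · intro hz
    have hz' : ∀ᵐ z ∂((surf d).prod (surf d)), G z.1 = G z.2 := by
      filter_upwards [hz, surf_prod_ae_ne hd] with z h1 h2
      have := rieszKernel_pos hs hs' h2
      simpa [this.ne', sub_eq_zero] using h1
    have := ae_neBot.2 hne
    obtain ⟨x, hx⟩ := (Measure.ae_ae_of_ae_prod hz').exists
    exact ⟨G x, hx.mono fun y hy => hy.symm⟩
  · rintro ⟨c, hc⟩
    have h1 := Measure.quasiMeasurePreserving_fst (μ := surf d) (ν := surf d) |>.ae hc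
    have h2 := Measure.quasiMeasurePreserving_snd (μ := surf d) (ν := surf d) |>.ae hc
    filter_upwards [h1, h2] with z h1 h2
    simp [h1, h2]

/-- The adjoint of the trace operator. -/
noncomputable def traceAdjoint (hd : 2 ≤ d) (hs : 1 / 2 < s) (hs' : s < (d : ℝ) / 2) :
    L2Sph d →L[ℂ] L2Rd d :=
  LinearMap.mkContinuous
    { toFun := fun G => 𝓕⁻ (symbolLp hd hs hs' G)
      map_add' := fun G H => by rw [symbolLp_add, FourierTransform.fourierInv_add]
      map_smul' := fun c G => by rw [symbolLp_smul, FourierTransform.fourierInv_smul]; rfl }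
    (√(traceEigenvalue d s 0)) fun G => by
      have h := norm_symbolLp_sq_le hd hs hs' G
      have h1 : ‖(𝓕⁻ (symbolLp hd hs hs' G) : L2Rd d)‖ = ‖symbolLp hd hs hs' G‖ := by
        rw [← Lp.norm_fourier_eq, FourierTransform.fourier_fourierInv_eq]
      simp only [LinearMap.coe_mk, AddHom.coe_mk, h1]
      rwa [← pow_le_pow_iff_left₀ (norm_nonneg _) (by positivity) two_ne_zero, mul_pow,
        Real.sq_sqrt (traceEigenvalue_pos hs hs' 0).le]

lemma fourier_traceAdjoint (hd : 2 ≤ d) (hs : 1 / 2 < s) (hs' : s < (d : ℝ) / 2) (G : L2Sph d) :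
    (𝓕 (traceAdjoint hd hs hs' G) : L2Rd d) = symbolLp hd hs hs' G :=
  FourierTransform.fourier_fourierInv_eq _

lemma norm_traceAdjoint (hd : 2 ≤ d) (hs : 1 / 2 < s) (hs' : s < (d : ℝ) / 2) (G : L2Sph d) :
    ‖traceAdjoint hd hs hs' G‖ = ‖symbolLp hd hs hs' G‖ := by
  rw [← Lp.norm_fourier_eq, fourier_traceAdjoint]

lemma inner_traceAdjoint (hd : 2 ≤ d) (hs : 1 / 2 < s) (hs' : s < (d : ℝ) / 2) (H G : L2Sph d) :
    inner ℂ (traceAdjoint hd hs hs' H) (traceAdjoint hd hs hs' G) =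
      ∫ z : Sph d × Sph d, (rieszKernel s z.1 z.2 : ℂ) * tensor H G z
        ∂((surf d).prod (surf d)) := by
  rw [← Lp.inner_fourier_eq, fourier_traceAdjoint, fourier_traceAdjoint, inner_symbolLp]

end operator

/-! ### Existence and uniqueness of the trace operator; the eigenfunction relation. -/

section trace
variable {d : ℕ} {s : ℝ}

lemma dNeg_eq (g : L2Rd d) (x : Rd d) : dNeg s g x =
    ∫ ξ, Complex.exp (((2 * Real.pi * inner ℝ ξ x : ℝ) : ℂ) * Complex.I) * dNegFourier s g ξ :=
  Real.fourierInv_eq' _ _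

lemma continuous_dNeg {g : L2Rd d} (hg : Integrable (dNegFourier s g)) :
    Continuous (dNeg s g) := by
  rw [funext (dNeg_eq g)]
  refine continuous_of_dominated (bound := fun ξ => ‖dNegFourier s g ξ‖) (fun x => ?_)
    (fun x => ?_) hg.norm (ae_of_all _ fun ξ => by fun_prop)
  · exact AEStronglyMeasurable.mul (by apply Continuous.aestronglyMeasurable; fun_prop)
      hg.aestronglyMeasurable
  · exact ae_of_all _ fun ξ => by rw [norm_mul, Complex.norm_exp_ofReal_mul_I, one_mul]

lemma memLp_restrictSph_dNeg {g : L2Rd d} (hg : Integrable (dNegFourier s g)) :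
    MemLp (restrictSph (dNeg s g)) 2 (surf d) := by
  have hc : Continuous (restrictSph (dNeg s g)) := (continuous_dNeg hg).comp continuous_subtype_val
  obtain ⟨C, hC⟩ := isCompact_univ.exists_bound_of_continuousOn (s := Set.univ) hc.continuousOn
  exact MemLp.of_bound hc.aestronglyMeasurable_of_compactSpace C
    (ae_of_all _ fun x => hC x (Set.mem_univ x))

/-- Paired with `H`, both sides are the same double integral over frequency and sphere. Fubini
applies because `dNegFourier s g` and `H` are integrable and the phase has modulus one. -/
lemma isTraceOp_adjoint_traceAdjoint (hd : 2 ≤ d) (hs : 1 / 2 < s) (hs' : s < (d : ℝ) / 2) :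
    IsTraceOp d s (traceAdjoint hd hs hs').adjoint := by
  intro g hg
  have hm := memLp_restrictSph_dNeg hg
  suffices (traceAdjoint hd hs hs').adjoint g = hm.toLp _ by
    rw [this]; exact hm.coeFn_toLp
  refine ext_inner_left ℂ fun H => ?_
  rw [ContinuousLinearMap.adjoint_inner_right, ← Lp.inner_fourier_eq, fourier_traceAdjoint,
    L2.inner_def, L2.inner_def]
  have e1 : ∫ ξ, inner ℂ ((symbolLp hd hs hs' H) ξ) ((𝓕 g : L2Rd d) ξ) =
      ∫ ξ, ∫ ω : Sph d, starRingEnd ℂ (H ω) *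
        (Complex.exp (((2 * Real.pi * inner ℝ ξ (ω : Rd d) : ℝ) : ℂ) * Complex.I) *
          dNegFourier s g ξ) ∂(surf d) := by
    refine integral_congr_ae ?_
    filter_upwards [coeFn_symbolLp hd hs hs' H] with ξ h1
    rw [h1, RCLike.inner_apply, extSymbol, map_mul, Complex.conj_ofReal, sphFourier, extensionOp,
      ← integral_conj, dNegFourier, ← mul_assoc, mul_comm ((𝓕 g : L2Rd d) ξ),
      ← integral_const_mul]
    refine integral_congr_ae (ae_of_all _ fun ω => ?_)
    simp only
    rw [map_mul, ← Complex.exp_conj]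
    simp only [map_mul, map_neg, Complex.conj_I, Complex.conj_ofReal, neg_neg, inner_smul_right]
    rw [real_inner_comm ξ (ω : Rd d), mul_comm Complex.I]
    ring
  have e2 : ∫ ω, inner ℂ (H ω) ((hm.toLp _ : L2Sph d) ω) ∂(surf d) =
      ∫ ω : Sph d, (∫ ξ : Rd d, starRingEnd ℂ (H ω) *
        (Complex.exp (((2 * Real.pi * inner ℝ ξ (ω : Rd d) : ℝ) : ℂ) * Complex.I) *
          dNegFourier s g ξ)) ∂(surf d) := by
    refine integral_congr_ae ?_
    filter_upwards [hm.coeFn_toLp] with ω h1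
    rw [h1, RCLike.inner_apply, restrictSph, dNeg_eq, mul_comm, integral_const_mul]
  rw [e1, e2]
  refine integral_integral_swap ?_
  have hI := hg.mul_prod ((Complex.conjLIE.integrable_comp_iff).2 (integrable_L2Sph H))
  refine (hI.bdd_mul (c := 1) (f := fun z : Rd d × Sph d =>
    Complex.exp (((2 * Real.pi * inner ℝ z.1 (z.2 : Rd d) : ℝ) : ℂ) * Complex.I))
    (by apply Continuous.aestronglyMeasurable; fun_prop)
    (ae_of_all _ fun z => (Complex.norm_exp_ofReal_mul_I _).le)).congr (ae_of_all _ fun z => ?_)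
  simp only [Function.uncurry, Complex.conjLIE_apply]
  ring

/-- Functions whose Fourier transform is supported in an annulus suffice to test against. -/
lemma eq_zero_of_inner_eq_zero (hd : 2 ≤ d) (hs : 0 < s) (h : L2Rd d)
    (hh : ∀ g : L2Rd d, Integrable (dNegFourier s g) → inner ℂ h g = 0) : h = 0 := by
  -- The lower bound keeps `|2πξ|^(-s)` bounded on `A n`; the upper bound gives `A n` finite
  -- measure, so that square integrable functions on it are integrable.
  set A : ℕ → Set (Rd d) := fun n =>
    {ξ | 1 / (n + 1 : ℝ) ≤ ‖(2 * Real.pi) • ξ‖ ∧ ‖ξ‖ ≤ n} with hA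
  have hAm : ∀ n, MeasurableSet (A n) := fun n => by
    have h1 : Measurable fun ξ : Rd d => ‖(2 * Real.pi) • ξ‖ := by fun_prop
    exact (measurableSet_le measurable_const h1).inter
      (measurableSet_le measurable_norm measurable_const)
  have hAf : ∀ n, volume (A n) < ⊤ := fun n =>
    (measure_mono (fun ξ hξ => mem_closedBall_zero_iff.2 hξ.2)).trans_lt
      (measure_closedBall_lt_top (x := (0 : Rd d)) (r := n))
  set f : L2Rd d := 𝓕 h with hf
  have hz : ∀ n, ∀ᵐ ξ, ξ ∈ A n → f ξ = 0 := fun n => by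
    have hmem : MemLp ((A n).indicator f) 2 := (Lp.memLp f).indicator (hAm n)
    -- The test function is the frequency cutoff of `h` itself, so `⟪h, g⟫` is the integral of
    -- `|f|²` over `A n`.
    set g : L2Rd d := 𝓕⁻ (hmem.toLp _) with hgdef
    have hFg : (𝓕 g : L2Rd d) =ᵐ[volume] (A n).indicator f := by
      rw [hgdef, FourierTransform.fourier_fourierInv_eq]
      exact hmem.coeFn_toLp
    have hint : Integrable ((A n).indicator f) := by
      rw [integrable_indicator_iff (hAm n)]
      have : IsFiniteMeasure (volume.restrict (A n)) := ⟨by simpa using hAf n⟩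
      exact ((Lp.memLp f).restrict (A n)).integrable one_le_two
    have hgood : Integrable (dNegFourier s g) := by
      have hb : Integrable (fun ξ => (((A n).indicator
          (fun ξ => ‖(2 * Real.pi) • ξ‖ ^ (-s)) ξ : ℝ) : ℂ) * (A n).indicator f ξ) := by
        refine hint.bdd_mul (c := (1 / (n + 1 : ℝ)) ^ (-s)) ?_ (ae_of_all _ fun ξ => ?_)
        · have : Measurable ((A n).indicator (fun ξ : Rd d => ‖(2 * Real.pi) • ξ‖ ^ (-s))) :=
            Measurable.indicator (by fun_prop) (hAm n)
          exact (Complex.measurable_ofReal.comp this).aestronglyMeasurable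
        · rw [Complex.norm_real, Real.norm_of_nonneg
            (Set.indicator_nonneg (fun ξ _ => by positivity) ξ)]
          by_cases hξ : ξ ∈ A n
          · rw [Set.indicator_of_mem hξ]
            exact Real.rpow_le_rpow_of_nonpos (by positivity) hξ.1 (by linarith)
          · rw [Set.indicator_of_notMem hξ]; positivity
      refine hb.congr ?_
      filter_upwards [hFg] with ξ h1
      rw [dNegFourier, h1]
      by_cases hξ : ξ ∈ A n <;> simp [hξ]
    have h0 := hh g hgood
    rw [← Lp.inner_fourier_eq, L2.inner_def] at h0
    have h1 : ∫ ξ, ‖(A n).indicator f ξ‖ ^ 2 = 0 := by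
      have : ∫ ξ, (((‖(A n).indicator f ξ‖ ^ 2 : ℝ)) : ℂ) = 0 := by
        rw [← h0]
        refine integral_congr_ae ?_
        filter_upwards [hFg] with ξ h1
        rw [h1]
        by_cases hξ : ξ ∈ A n
        · rw [Set.indicator_of_mem hξ, ← hf, inner_self_eq_norm_sq_to_K]; push_cast; rfl
        · simp [Set.indicator_of_notMem hξ]
      rw [integral_complex_ofReal] at this
      exact_mod_cast this
    rw [integral_eq_zero_iff_of_nonneg (fun ξ => by positivity)
      ((memLp_two_iff_integrable_sq_norm hmem.1).1 hmem)] at h1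
    filter_upwards [h1] with ξ h2 hξ
    simpa [hξ] using h2
  have hne : ∀ᵐ ξ : Rd d, f ξ = 0 ∨ ξ = 0 := by
    filter_upwards [ae_all_iff.2 hz] with ξ h1
    by_cases h0 : ξ = 0
    · exact Or.inr h0
    · left
      have hpos : 0 < ‖(2 * Real.pi) • ξ‖ := norm_pos_iff.2 (smul_ne_zero (by positivity) h0)
      obtain ⟨n, hn⟩ := exists_nat_one_div_lt hpos
      obtain ⟨m, hm⟩ := exists_nat_ge ‖ξ‖
      refine h1 (max n m) ⟨le_trans ?_ hn.le, hm.trans (by exact_mod_cast le_max_right n m)⟩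
      have : (n : ℝ) ≤ (max n m : ℕ) := by exact_mod_cast le_max_left n m
      gcongr
  have := nontrivial_Rd (by omega : 0 < d)
  have hf0 : f = 0 := by
    refine Lp.ext ?_
    filter_upwards [hne, Measure.ae_ne volume (0 : Rd d), Lp.coeFn_zero ℂ 2 volume] with ξ h1 h2 h3
    rw [h3]
    exact h1.resolve_right h2
  rw [← norm_eq_zero, ← Lp.norm_fourier_eq, ← hf, hf0, norm_zero]

/-- The difference kills every admissible `g`, so each value of its adjoint is orthogonal to all of
them and vanishes by `eq_zero_of_inner_eq_zero`. -/
lemma IsTraceOp.unique (hd : 2 ≤ d) (hs : 0 < s) {S S' : L2Rd d →L[ℂ] L2Sph d} (hS : IsTraceOp d s S)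
    (hS' : IsTraceOp d s S') : S = S' := by
  have h : (S - S').adjoint = 0 := by
    ext1 H
    refine eq_zero_of_inner_eq_zero hd hs _ fun g hg => ?_
    have : (S - S') g = 0 := by
      rw [sub_apply, sub_eq_zero]
      exact Lp.ext ((hS g hg).trans (hS' g hg).symm)
    rw [ContinuousLinearMap.adjoint_inner_left, this, inner_zero_right]
  have h2 := congrArg ContinuousLinearMap.adjoint h
  rw [ContinuousLinearMap.adjoint_adjoint, map_zero] at h2
  exact sub_eq_zero.1 h2

lemma adjoint_traceAdjoint_traceAdjoint (hd : 2 ≤ d) (hs : 1 / 2 < s) (hs' : s < (d : ℝ) / 2)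
    {k : ℕ} {Y : L2Sph d} (hY : IsSphericalHarmonic d k Y) :
    (traceAdjoint hd hs hs').adjoint (traceAdjoint hd hs hs' Y) =
      (traceEigenvalue d s k : ℂ) • Y := by
  obtain ⟨P, hP1, hP2, hY⟩ := hY
  change Y =ᵐ[surf d] fun ω => polyFun P (ω : Rd d) at hY
  refine ext_inner_left ℂ fun H => ?_
  rw [ContinuousLinearMap.adjoint_inner_right, inner_traceAdjoint, inner_smul_right, L2.inner_def,
    integral_prod _ (integrable_rieszKernel_tensor hd hs hs' H Y), ← integral_const_mul]
  refine integral_congr_ae ?_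
  filter_upwards [hY] with x hx
  have e : ∫ y, (rieszKernel s x y : ℂ) * tensor H Y (x, y) ∂(surf d) =
      starRingEnd ℂ (H x) * ∫ y, (rieszKernel s x y : ℂ) * polyFun P (y : Rd d) ∂(surf d) := by
    rw [← integral_const_mul]
    refine integral_congr_ae ?_
    filter_upwards [hY] with y hy
    rw [tensor, hy]; ring
  rw [e, integral_rieszKernel_mul hd hs hs' ⟨hP1, hP2⟩, RCLike.inner_apply, hx]
  ring

end trace

theorem theorem2 (d : ℕ) (hd : 2 ≤ d) (s : ℝ) (hs : 1 / 2 < s) (hs' : s < (d : ℝ) / 2) :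
    -- the eigenvalues strictly decrease to zero
    StrictAnti (traceEigenvalue d s) ∧
    Tendsto (traceEigenvalue d s) atTop (𝓝 0) ∧
    -- the bounded operator `𝓡 D^{-s}` exists and is unique
    (∃! S : L2Rd d →L[ℂ] L2Sph d, IsTraceOp d s S) ∧
    ∀ S : L2Rd d →L[ℂ] L2Sph d, IsTraceOp d s S →
      -- the Fourier transform of `S* G` is `|·|^{-s} (G dσ)^`
      (∀ G : L2Sph d,
        (𝓕 (S.adjoint G) : L2Rd d) =ᵐ[(volume : Measure (Rd d))]
          fun ξ => ((‖(2 * Real.pi) • ξ‖ ^ (-s) : ℝ) : ℂ) * extensionOp G ((2 * Real.pi) • ξ)) ∧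
      -- spherical harmonics of degree `k` are eigenfunctions
      (∀ (k : ℕ) (Y : L2Sph d), IsSphericalHarmonic d k Y →
        S (S.adjoint Y) = (traceEigenvalue d s k : ℂ) • Y) ∧
      -- the bound, with optimal constant and characterization of equality
      (∀ G : L2Sph d, ‖S.adjoint G‖ ^ 2 ≤ traceEigenvalue d s 0 * ‖G‖ ^ 2) ∧
      (∀ C : ℝ, (∀ G : L2Sph d, ‖S.adjoint G‖ ^ 2 ≤ C * ‖G‖ ^ 2) → traceEigenvalue d s 0 ≤ C) ∧
      (∀ G : L2Sph d, ‖S.adjoint G‖ ^ 2 = traceEigenvalue d s 0 * ‖G‖ ^ 2 ↔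
        ∃ c : ℂ, G =ᵐ[surf d] fun _ => c) := by
  have hs0 : 0 < s := by linarith
  have hT := isTraceOp_adjoint_traceAdjoint hd hs hs'
  refine ⟨strictAnti_traceEigenvalue hs hs', tendsto_traceEigenvalue hs hs',
    ⟨_, hT, fun S hS => hS.unique hd hs0 hT⟩, fun S hS => ?_⟩
  -- By uniqueness an arbitrary trace operator is the explicit one, whose adjoint is `traceAdjoint`.
  obtain rfl := hS.unique hd hs0 hT
  rw [ContinuousLinearMap.adjoint_adjoint]
  refine ⟨fun G => ?_, fun k Y hY => adjoint_traceAdjoint_traceAdjoint hd hs hs' hY, fun G => ?_,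
    fun C hC => ?_, fun G => ?_⟩
  · rw [fourier_traceAdjoint]
    exact coeFn_symbolLp hd hs hs' G
  · rw [norm_traceAdjoint]
    exact norm_symbolLp_sq_le hd hs hs' G
  -- Optimality is tested on the constant `1`, for which equality holds and whose norm is positive
  -- since the surface measure is nonzero.
  · have := nontrivial_Rd (by omega : 0 < d)
    have hne : surf d ≠ 0 := Measure.toSphere_ne_zero _
    have h1 : MemLp (fun _ : Sph d => (1 : ℂ)) 2 (surf d) := memLp_const 1
    have hG := (norm_symbolLp_sq_eq_iff hd hs hs' (h1.toLp _)).2 ⟨1, h1.coeFn_toLp⟩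
    have h2 := hC (h1.toLp _)
    rw [norm_traceAdjoint, hG] at h2
    refine le_of_mul_le_mul_right h2 ?_
    have : h1.toLp _ ≠ 0 := fun h0 => by
      have h3 := h1.coeFn_toLp
      rw [h0] at h3
      have := ae_neBot.2 hne
      obtain ⟨x, hx, hx'⟩ := (h3.and (Lp.coeFn_zero ℂ 2 (surf d))).exists
      rw [hx'] at hx
      simp at hx
    have := norm_pos_iff.2 this
    positivity
  · rw [norm_traceAdjoint]
    exact norm_symbolLp_sq_eq_iff hd hs hs' G
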